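/- Let $\Gamma=(V,E)$ be a finite undirected graph, self-loops allowed, and let $\bar V=\{\bar v\mid v\in V\}$ be a disjoint copy of $V$. The graph monoid $\mathbb{M}_\Gamma$ is the quotient of the free monoid $(V\cup\bar V)^*$ by the least congruence with $v\bar v\equiv\varepsilon$ for all $v\in V$, and $xy\equiv yx$ for all $x\in\{u,\bar u\}$, $y\in\{v,\bar v\}$ with $\{u,v\}\in E$ (where $u=v$ is allowed). Write $[w]\in\mathbb{M}_\Gamma$ for the class of a word $w$. A valence game arena over $\Gamma$ consists of a finite set $Q=Q_\exists\sqcup Q_\forall$ of states, partitioned into the states of the existential and of the universal player, an initial state $q_{init}\in Q$, and a finite set $\delta\subseteq Q\times(V\cup\bar V)^*\times Q$ of transitions, such that every state has at least one outgoing transition and for all $p,q\in Q$ there is at most one transition from $p$ to $q$. A configuration is a pair in $Q\times\mathbb{M}_\Gamma$. A play is an infinite sequence of configurations $(q_1,x_1)(q_2,x_2)\cdots$ such that for every $i$ there is $(q_i,w,q_{i+1})\in\delta$ with $x_{i+1}=x_i[w]$. A strategy of the existential player is a map $\sigma\colon Q^*Q_\exists\to Q$ such that $\sigma(uq)=q'$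 implies $(q,w,q')\in\delta$ for some $w$; a play is compliant with $\sigma$ if $\sigma(q_1\cdots q_i)=q_{i+1}$ whenever $q_i\in Q_\exists$. The existential player wins a configuration $(q,x)$ (for the right-invertibility objective) if she has a strategy $\sigma$ such that in every play that starts in $(q,x)$ and is compliant with $\sigma$, all the monoid elements $x_i$ are right-invertible in $\mathbb{M}_\Gamma$. The problem $\mathsf{FV}(\Gamma)$ (fixed initial credit) is: given a valence game arena over $\Gamma$ and a word $w\in(V\cup\bar V)^*$, does the existential player win $(q_{init},[w])$? The problem $\mathsf{UV}(\Gamma)$ (unknown initial credit) is: given a valence game arena over $\Gamma$, is there a word $w\in(V\cup\bar V)^*$ such that the existential player wins $(q_{init},[w])$? Let $\Gamma$ be one of the following two graphs on the vertex set $\{a,b,c\}$: (iii) the path with edges $\{a,b\},\{b,c\}$ and no self-loops; (iv) the path with edges $\{a,b\},\{b,c\}$ together with a self-loop on $c$, and no other self-loops. Then $\mathsf{FV}(\Gamma)$ and $\mathsf{UV}(\Gamma)$ are both undecidable. -/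

import Mathlib

/-- An undirected graph with vertex type `V`, self-loops allowed, given by its
set of edges: the edge between `u` and `v` is the unordered pair `s(u, v)`, and a self-loop on `v`
is `s(v, v)`. -/
abbrev ValenceGraph (V : Type) := Set (Sym2 V)

/-- The alphabet `V ∪ V̄`: `(v, false)` is the letter `v`, and `(v, true)` is the letter `v̄`. -/
abbrev Letter (V : Type) := V × Bool

/-- The defining relations of the graph monoid: `v v̄ = 1` for every vertex `v`, and
`x y = y x` for `x ∈ {u, ū}`, `y ∈ {v, v̄}` whenever `{u, v}` is an edge (possibly `u = v`). -/
inductive GraphRel {V : Type} (Γ : ValenceGraph V) :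
    FreeMonoid (Letter V) → FreeMonoid (Letter V) → Prop
  | cancel (v : V) :
      GraphRel Γ (FreeMonoid.of (v, false) * FreeMonoid.of (v, true)) 1
  | comm (x y : Letter V) (h : s(x.1, y.1) ∈ Γ) :
      GraphRel Γ (FreeMonoid.of x * FreeMonoid.of y) (FreeMonoid.of y * FreeMonoid.of x)

/-- The graph monoid of `Γ`: words over `V ∪ V̄` modulo the least congruence containing the
defining relations. -/
abbrev GraphMonoid {V : Type} (Γ : ValenceGraph V) := PresentedMonoid (GraphRel Γ)

/-- The element `[w]` of the graph monoid represented by the word `w`. -/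
def wordClass {V : Type} (Γ : ValenceGraph V) (w : List (Letter V)) : GraphMonoid Γ :=
  PresentedMonoid.mk (GraphRel Γ) (FreeMonoid.ofList w)

/-- The set of right-invertible elements of a monoid. -/
def RInv (M : Type) [Monoid M] : Set M := {x | ∃ y, x * y = 1}

/-- The two players. -/
inductive Player
  | existential
  | universal

/-- A valence game arena over a graph with vertex type `V`, with set of states `Q`: every state has
an owner, there is a finite set of transitions labelled by words over `V ∪ V̄`, and there is an
initial state. Every state has an outgoing transition, and there is at most one transition from a
state to another. -/
structure GameArena (V Q : Type) where
  owner : Q → Player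
  δ : Finset (Q × List (Letter V) × Q)
  init : Q
  exists_transition : ∀ p : Q, ∃ (x : List (Letter V)) (q : Q), (p, x, q) ∈ δ
  transition_unique : ∀ (p q : Q) (x y : List (Letter V)), (p, x, q) ∈ δ → (p, y, q) ∈ δ → x = y

/-- Configurations: a state together with an element of the graph monoid. -/
abbrev Conf {V : Type} (Γ : ValenceGraph V) (Q : Type) := Q × GraphMonoid Γ

namespace GameArena

/-- A play is an infinite run: each step takes a transition and multiplies its label from the
right onto the current monoid element. -/
def IsPlay {V Q : Type} (Γ : ValenceGraph V) (A : GameArena V Q) (π : ℕ → Conf Γ Q) : Prop :=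
  ∀ i : ℕ, ∃ x : List (Letter V),
    ((π i).1, x, (π (i + 1)).1) ∈ A.δ ∧ (π (i + 1)).2 = (π i).2 * wordClass Γ x

/-- A strategy of player `ι`: it maps a history `w` followed by a current state `q` owned by `ι`
to a successor state of `q`. (The value at states that are not owned by `ι` is irrelevant.) -/
structure Strategy {V Q : Type} (A : GameArena V Q) (ι : Player) where
  next : List Q → Q → Q
  legal : ∀ (w : List Q) (q : Q), A.owner q = ι →
    ∃ x : List (Letter V), (q, x, next w q) ∈ A.δ

/-- The play `π` is compliant with the strategy `σ`. -/
def Compliant {V Q : Type} {Γ : ValenceGraph V} {A : GameArena V Q} {ι : Player}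
    (σ : A.Strategy ι) (π : ℕ → Conf Γ Q) : Prop :=
  ∀ i : ℕ, A.owner (π i).1 = ι →
    σ.next ((List.range i).map fun j => (π j).1) (π i).1 = (π (i + 1)).1

/-- Player `ι` wins the configuration `s` for the objective `Obj`: some strategy of `ι` is such
that all compliant plays from `s` are in `Obj` (for the existential player), respectively outside
`Obj` (for the universal player). -/
def Wins {V Q : Type} {Γ : ValenceGraph V} (A : GameArena V Q) (Obj : Set (ℕ → Conf Γ Q))
    (ι : Player) (s : Conf Γ Q) : Prop :=
  ∃ σ : A.Strategy ι, ∀ π : ℕ → Conf Γ Q,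
    A.IsPlay Γ π → π 0 = s → Compliant σ π → (π ∈ Obj ↔ ι = Player.existential)

end GameArena

/-- The right-invertibility objective: all visited monoid elements are right-invertible. -/
def rightInvObjective {V : Type} (Γ : ValenceGraph V) (Q : Type) : Set (ℕ → Conf Γ Q) :=
  {π | ∀ i : ℕ, (π i).2 ∈ RInv (GraphMonoid Γ)}

/-- A finite description of a game arena as a combinatorial object: the number of states, the list
of the states owned by the universal player, the list of transitions, the initial state.
States are represented by natural numbers. -/
abbrev ArenaCode (V : Type) :=
  ℕ × List ℕ × List (ℕ × List (Letter V) × ℕ) × ℕ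

/-- `c` is a description of the game arena `A`, whose states are `0, …, n - 1`. -/
def ArenaCode.Describes {V : Type} (c : ArenaCode V) {n : ℕ} (A : GameArena V (Fin n)) : Prop :=
  c.1 = n ∧
  (∀ p : ℕ, p ∈ c.2.1 ↔ ∃ p' : Fin n, (p' : ℕ) = p ∧ A.owner p' = Player.universal) ∧
  (∀ (p : ℕ) (x : List (Letter V)) (q : ℕ), (p, x, q) ∈ c.2.2.1 ↔
    ∃ p' q' : Fin n, (p' : ℕ) = p ∧ (q' : ℕ) = q ∧ (p', x, q') ∈ A.δ) ∧
  c.2.2.2 = (A.init : ℕ)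

/-- A decision problem: among the elements of `α` there are the (well-formed) instances, and some
instances are yes-instances. -/
structure DecisionProblem (α : Type) where
  instances : Set α
  yes : Set α
  yes_subset : yes ⊆ instances

/-- A problem is decidable if some computable function answers correctly on every instance.
(Nothing is required of its answers on inputs that are not instances.) -/
def DecisionProblem.IsDecidable {α : Type} [Primcodable α] (P : DecisionProblem α) : Prop :=
  ∃ f : α → Bool, Computable f ∧ ∀ x ∈ P.instances, (f x = true ↔ x ∈ P.yes)

/-- The fixed initial credit problem. Given a game arena and a word `w`, does the existential
player win `(q_init, [w])` for the right-invertibility objective over `Γ`? -/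
def FV {V : Type} (Γ : ValenceGraph V) : DecisionProblem (ArenaCode V × List (Letter V)) where
  instances := {I | ∃ (n : ℕ) (A : GameArena V (Fin n)), ArenaCode.Describes I.1 A}
  yes := {I | ∃ (n : ℕ) (A : GameArena V (Fin n)), ArenaCode.Describes I.1 A ∧
    A.Wins (rightInvObjective Γ (Fin n)) Player.existential (A.init, wordClass Γ I.2)}
  yes_subset := fun _ ⟨n, A, h, _⟩ => ⟨n, A, h⟩

/-- The unknown initial credit problem. Given a game arena, is there a word `w` such that the
existential player wins `(q_init, [w])` for the right-invertibility objective over `Γ`? -/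
def UV {V : Type} (Γ : ValenceGraph V) : DecisionProblem (ArenaCode V) where
  instances := {c | ∃ (n : ℕ) (A : GameArena V (Fin n)), ArenaCode.Describes c A}
  yes := {c | ∃ (n : ℕ) (A : GameArena V (Fin n)), ArenaCode.Describes c A ∧
    ∃ w : List (Letter V),
      A.Wins (rightInvObjective Γ (Fin n)) Player.existential (A.init, wordClass Γ w)}
  yes_subset := fun _ ⟨n, A, h, _⟩ => ⟨n, A, h⟩

/-- Graph (iii): the path `a — b — c` on the vertices `a = 0`, `b = 1`, `c = 2`, without loops. -/
def graphIII : ValenceGraph (Fin 3) := {s(0, 1), s(1, 2)}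

/-- Graph (iv): the path `a — b — c` with a self-loop on the end vertex `c`, and no other loop. -/
def graphIV : ValenceGraph (Fin 3) := {s(0, 1), s(1, 2), s(2, 2)}

/-!
The halting problem of nondeterministic counter machines is reduced to the complement of both
problems, by one game arena that serves both graphs.

Storage. In both graphs `b` is a counter that must not become negative and commutes with the other
letters, which form a stack. Two stack symbols are stored as `a a` and `a c a`. Popping the wrong
one makes the monoid element lose right-invertibility for good, even in graph (iv), where `c` is
invertible: graph (iv) acts partially on stacks of integers (`wordAct`), graph (iii) acts through
graph (iv), and a word with an undefined action is not right-invertible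
(`notMem_RInv_of_wordAct_eq_none`).

The game (`GameState`). The universal player runs the machine. After each operation he pushes the
new values of all counters, in unary, on top of the old ones, while `b` is kept at the sum of the
counters plus a surplus `B`. He aims at the final state of the machine, where `b` is decremented for
ever. The existential player may complain that a new value is too small or too large. Then the new
and the old block are popped and `b` is changed by suitable weights, so that the surplus becomes
`B + d - 1`, where `d` is the size of the alleged error; comparisons with the old values are
possible because `b` bounds their sum. Thereafter the game starts afresh above whatever is left on the stack.
A justified complaint therefore costs nothing, and an unjustified one costs at least one unit of
surplus.

If the machine does not halt, then the existential player wins from the empty word by making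
justified complaints only (`GameState.Inv`). If it halts, then the universal player runs it honestly
and wins from every initial credit, by induction on the surplus (`GameState.losesFrom_start`). So
fixed and unknown initial credit have the same answer, and since the input of the machine affects a
single label, the arena is computable from it (`GameState.exists_computable_code`).

The machine with an undecidable halting problem guesses a number of steps and evaluates the
primitive recursive step-bounded interpreter of partial recursive functions
(`exists_undecidable_machine`). Primitive recursive functions are compiled to counter programs in
`Prog.exists_does_of_primrec`.
-/

/-! ### Graph monoids: right-invertible words and a partial action -/

section Monoid

variable {V : Type} {Γ : ValenceGraph V}

theorem wordClass_append (u v : List (Letter V)) :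
    wordClass Γ (u ++ v) = wordClass Γ u * wordClass Γ v := by
  simp [wordClass, FreeMonoid.ofList_append]

theorem wordClass_nil : wordClass Γ [] = 1 := by
  simp [wordClass]

theorem exists_wordClass_eq (m : GraphMonoid Γ) : ∃ w, wordClass Γ w = m := by
  obtain ⟨w, rfl⟩ := PresentedMonoid.surjective_mk m
  exact ⟨w.toList, rfl⟩

theorem wordClass_cancel (v : V) : wordClass Γ [(v, false), (v, true)] = 1 :=
  PresentedMonoid.mk_eq_mk_of_rel (GraphRel.cancel v)

theorem wordClass_swap {x y : Letter V} (h : s(x.1, y.1) ∈ Γ) :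
    Commute (wordClass Γ [x]) (wordClass Γ [y]) :=
  PresentedMonoid.mk_eq_mk_of_rel (GraphRel.comm x y h)

/-- A letter commutes with every word over the neighbours of its vertex. -/
theorem wordClass_commute {x : Letter V} {u : List (Letter V)} (h : ∀ y ∈ u, s(x.1, y.1) ∈ Γ) :
    Commute (wordClass Γ [x]) (wordClass Γ u) := by
  induction u with
  | nil => rw [wordClass_nil]; exact Commute.one_right _
  | cons y u ih =>
    rw [← List.singleton_append, wordClass_append]
    exact (wordClass_swap (h y (by simp))).mul_right (ih fun z hz => h z (by simp [hz]))

theorem RInv.mul {M : Type} [Monoid M] {x y : M} (hx : x ∈ RInv M) (hy : y ∈ RInv M) :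
    x * y ∈ RInv M := by
  obtain ⟨x', hx⟩ := hx
  obtain ⟨y', hy⟩ := hy
  exact ⟨y' * x', by rw [mul_assoc, ← mul_assoc y, hy, one_mul, hx]⟩

theorem wordClass_mem_RInv {u : List (Letter V)} (h : ∀ x ∈ u, x.2 = false) :
    wordClass Γ u ∈ RInv (GraphMonoid Γ) := by
  induction u with
  | nil => exact ⟨1, by simp [wordClass_nil]⟩
  | cons x u ih =>
    rw [← List.singleton_append, wordClass_append]
    refine RInv.mul ⟨wordClass Γ [(x.1, true)], ?_⟩ (ih fun y hy => h y (by simp [hy]))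
    have hx : x = (x.1, false) := Prod.ext rfl (h x (by simp))
    rw [hx, ← wordClass_append]
    exact wordClass_cancel _

end Monoid

/-- Contents of the storage of graph (iv): a stack over the letter `a` with a power of the
invertible letter `c` above every occurrence of `a`, and the value of the counter `b`. The stack is
given by the exponent of `c` on top, followed by the list of the exponents below. -/
abbrev Store : Type := (ℤ × List ℤ) × ℕ

/-- The partial action of a letter on storage contents: `a` and `ā` push and pop, `c` and `c̄`
change the exponent on top, `b` and `b̄` change the counter. Undefined results are `none`. -/
def letterAct : Letter (Fin 3) → Store → Option Store
  | (0, false), ((k, l), n) => some ((0, k :: l), n)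
  | (0, true), ((k, l), n) => if k = 0 then l.head?.map fun h => ((h, l.tail), n) else none
  | (1, false), (s, n) => some (s, n + 1)
  | (1, true), (s, n) => if n = 0 then none else some (s, n - 1)
  | (2, false), ((k, l), n) => some ((k + 1, l), n)
  | (2, true), ((k, l), n) => some ((k - 1, l), n)

/-- The partial action of words on storage contents. -/
def wordAct : List (Letter (Fin 3)) → Store → Option Store
  | [], s => some s
  | x :: u, s => (letterAct x s).bind (wordAct u)

theorem wordAct_append (u v : List (Letter (Fin 3))) (s : Store) :
    wordAct (u ++ v) s = (wordAct u s).bind (wordAct v) := by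
  induction u generalizing s with
  | nil => rfl
  | cons x u ih => simp [wordAct, ih, Option.bind_assoc]

/-- The congruence on words of having the same action. -/
def actCon : Con (FreeMonoid (Letter (Fin 3))) where
  r u v := ∀ s, wordAct u.toList s = wordAct v.toList s
  iseqv := ⟨fun _ _ => rfl, fun h s => (h s).symm, fun h h' s => (h s).trans (h' s)⟩
  mul' h h' s := by
    simp only [FreeMonoid.toList_mul, wordAct_append, h s]
    congr 1
    exact funext h'

theorem letterAct_cancel (v : Fin 3) (s : Store) :
    (letterAct (v, false) s).bind (letterAct (v, true)) = some s := by
  fin_cases v <;> simp [letterAct]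

theorem letterAct_comm (x y : Letter (Fin 3)) (h : s(x.1, y.1) ∈ graphIV) (s : Store) :
    (letterAct x s).bind (letterAct y) = (letterAct y s).bind (letterAct x) := by
  obtain ⟨x, p⟩ := x
  obtain ⟨y, q⟩ := y
  obtain ⟨⟨k, l⟩, n⟩ := s
  simp only [graphIV, Set.mem_insert_iff, Set.mem_singleton_iff, Sym2.eq_iff] at h
  rcases h with (⟨rfl, rfl⟩ | ⟨rfl, rfl⟩) | (⟨rfl, rfl⟩ | ⟨rfl, rfl⟩) | (⟨rfl, rfl⟩ | ⟨rfl, rfl⟩)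
  all_goals
    by_cases hk : k = 0 <;> cases p <;> cases q <;> rcases l with _ | ⟨h, l⟩ <;>
      rcases n with _ | n <;> simp [letterAct, hk]

/-- Graphs (iii) and (iv) both act on storage contents, since every edge of graph (iii) is one of
graph (iv). -/
theorem wordAct_eq_of_wordClass_eq {Γ : ValenceGraph (Fin 3)} (hΓ : Γ ⊆ graphIV)
    {u v : List (Letter (Fin 3))} (h : wordClass Γ u = wordClass Γ v) (s : Store) :
    wordAct u s = wordAct v s := by
  have hle : conGen (GraphRel Γ) ≤ actCon := by
    refine Con.conGen_le.2 ?_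
    rintro _ _ (⟨v⟩ | ⟨x, y, h⟩) s
    · simpa [wordAct] using letterAct_cancel v s
    · simpa [wordAct] using letterAct_comm x y (hΓ h) s
  exact hle (PresentedMonoid.mk_eq_mk_iff.1 h) s

theorem notMem_RInv_of_wordAct_eq_none {Γ : ValenceGraph (Fin 3)} (hΓ : Γ ⊆ graphIV)
    {u : List (Letter (Fin 3))} {s : Store} (h : wordAct u s = none) :
    wordClass Γ u ∉ RInv (GraphMonoid Γ) := by
  rintro ⟨y, hy⟩
  obtain ⟨v, rfl⟩ := exists_wordClass_eq y
  rw [← wordClass_append, ← wordClass_nil] at hy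
  have := wordAct_eq_of_wordClass_eq hΓ hy s
  simp [wordAct_append, h, wordAct] at this

/-! ### A binary stack with a counter inside the graph monoids -/

/-- The word pushing a symbol of the binary stack: `false` is stored as `a a` and `true` as
`a c a`. The enclosing letters `a` make popping the wrong symbol fail even when `c` is
invertible. -/
def pushWord (s : Bool) : List (Letter (Fin 3)) :=
  bif s then [(0, false), (2, false), (0, false)] else [(0, false), (0, false)]

/-- The word popping a symbol of the binary stack. -/
def popWord (s : Bool) : List (Letter (Fin 3)) :=
  bif s then [(0, true), (2, true), (0, true)] else [(0, true), (0, true)]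

/-- The word pushing the whole list `L` of symbols, whose head ends up on top. -/
def stackWord : List Bool → List (Letter (Fin 3))
  | [] => []
  | s :: L => stackWord L ++ pushWord s

/-- The word adding the integer `z` to the counter `b`. -/
def counterWord (z : ℤ) : List (Letter (Fin 3)) :=
  List.replicate z.natAbs (1, decide (z < 0))

/-- A transition label: a word acting on the stack, and an integer added to the counter. -/
abbrev Label : Type := List (Letter (Fin 3)) × ℤ

/-- The word over the letters of the graph which a label stands for. -/
def Label.word (ℓ : Label) : List (Letter (Fin 3)) := ℓ.1 ++ counterWord ℓ.2

section Positive

variable {Γ : ValenceGraph (Fin 3)}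

/-- The monoid element with stack contents `L` and counter value `n`. -/
def storeElem (Γ : ValenceGraph (Fin 3)) (L : List Bool) (n : ℕ) : GraphMonoid Γ :=
  wordClass Γ (stackWord L) * wordClass Γ [(1, false)] ^ n

theorem storeElem_nil_zero : storeElem Γ [] 0 = 1 := by
  simp [storeElem, stackWord, wordClass_nil]

theorem stackWord_append (L L' : List Bool) :
    stackWord (L ++ L') = stackWord L' ++ stackWord L := by
  induction L with
  | nil => simp [stackWord]
  | cons s L ih => simp [stackWord, ih]

theorem forall_mem_stackWord (L : List Bool) :
    ∀ x ∈ stackWord L, x.1 ≠ 1 ∧ x.2 = false := by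
  induction L with
  | nil => simp [stackWord]
  | cons s L ih =>
    intro x hx
    rcases List.mem_append.1 hx with hx | hx
    · exact ih x hx
    · cases s <;> simp [pushWord] at hx <;> grind

theorem ne_one_of_mem_popWord {s : Bool} : ∀ x ∈ popWord s, x.1 ≠ 1 := by
  cases s <;> simp [popWord]

theorem storeElem_mem_RInv (L : List Bool) (n : ℕ) : storeElem Γ L n ∈ RInv (GraphMonoid Γ) := by
  refine RInv.mul (wordClass_mem_RInv fun x hx => (forall_mem_stackWord L x hx).2) ?_
  induction n with
  | zero => exact ⟨1, by simp⟩
  | succ n ih =>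
    rw [pow_succ]
    exact RInv.mul ih (wordClass_mem_RInv (by simp))

theorem wordClass_replicate (x : Letter (Fin 3)) (n : ℕ) :
    wordClass Γ (List.replicate n x) = wordClass Γ [x] ^ n := by
  induction n with
  | zero => simp [wordClass_nil]
  | succ n ih => rw [List.replicate_succ', wordClass_append, ih, pow_succ]

theorem pow_mul_counterWord {n n' : ℕ} {z : ℤ} (h : (n : ℤ) + z = n') :
    wordClass Γ [(1, false)] ^ n * wordClass Γ (counterWord z) = wordClass Γ [(1, false)] ^ n' := by
  rw [counterWord, wordClass_replicate]
  by_cases hz : z < 0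
  · obtain rfl : n = n' + z.natAbs := by omega
    have hc : wordClass Γ [(1, false)] * wordClass Γ [(1, true)] = 1 := by
      rw [← wordClass_append]
      exact wordClass_cancel 1
    simp only [hz, decide_true, pow_add, mul_assoc]
    suffices ∀ m : ℕ, wordClass Γ [(1, false)] ^ m * wordClass Γ [(1, true)] ^ m = 1 by
      rw [this, mul_one]
    intro m
    induction m with
    | zero => simp
    | succ m ih =>
      rw [pow_succ, pow_succ', mul_assoc, ← mul_assoc (wordClass Γ [(1, false)]), hc, one_mul, ih]
  · obtain rfl : n' = n + z.natAbs := by omega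
    simp [hz, pow_add]

/-- The effect of a label on stack contents `L` and a counter value `n` in the monoid. -/
theorem storeElem_mul_word (h₁ : s(0, 1) ∈ Γ) (h₂ : s(1, 2) ∈ Γ) {L L' : List Bool} {n n' : ℕ}
    {v : List (Letter (Fin 3))} {z : ℤ} (hv : ∀ x ∈ v, x.1 ≠ 1)
    (hL : wordClass Γ (stackWord L ++ v) = wordClass Γ (stackWord L')) (hz : (n : ℤ) + z = n') :
    storeElem Γ L n * wordClass Γ (Label.word (v, z)) = storeElem Γ L' n' := by
  have hc : Commute (wordClass Γ [((1 : Fin 3), false)]) (wordClass Γ v) := by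
    refine wordClass_commute fun y hy => ?_
    have h01 : s((1 : Fin 3), 0) ∈ Γ := by rwa [Sym2.eq_swap]
    obtain ⟨y, p⟩ := y
    have := hv _ hy
    fin_cases y
    · exact h01
    · simp at this
    · exact h₂
  rw [storeElem, storeElem, Label.word, wordClass_append, mul_assoc,
    ← mul_assoc (wordClass Γ [(1, false)] ^ n), (hc.pow_left n).eq, mul_assoc,
    pow_mul_counterWord hz, ← mul_assoc, ← wordClass_append, hL]

theorem stackWord_append_pushWord (s : Bool) (L : List Bool) :
    wordClass Γ (stackWord L ++ pushWord s) = wordClass Γ (stackWord (s :: L)) := rfl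

theorem stackWord_cons_append_popWord (s : Bool) (L : List Bool) :
    wordClass Γ (stackWord (s :: L) ++ popWord s) = wordClass Γ (stackWord L) := by
  have key : ∀ (v : Fin 3) (u w : List (Letter (Fin 3))),
      wordClass Γ (u ++ ((v, false) :: (v, true) :: w)) = wordClass Γ (u ++ w) := by
    intro v u w
    rw [show u ++ (v, false) :: (v, true) :: w = u ++ ([(v, false), (v, true)] ++ w) by simp,
      wordClass_append, wordClass_append, wordClass_cancel, one_mul, wordClass_append]
  cases s
  · have h1 := key 0 (stackWord L ++ [(0, false)]) [(0, true)]
    have h2 := key 0 (stackWord L) []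
    simp only [stackWord, pushWord, popWord, cond_false, List.append_assoc, List.cons_append,
      List.nil_append, List.append_nil] at h1 h2 ⊢
    rw [h1, h2]
  · have h1 := key 0 (stackWord L ++ [(0, false), (2, false)]) [(2, true), (0, true)]
    have h2 := key 2 (stackWord L ++ [(0, false)]) [(0, true)]
    have h3 := key 0 (stackWord L) []
    simp only [stackWord, pushWord, popWord, cond_true, List.append_assoc, List.cons_append,
      List.nil_append, List.append_nil] at h1 h2 h3 ⊢
    rw [h1, h2, h3]

end Positive

/-- The stack obtained from an arbitrary stack by pushing a symbol. -/
def pushStack (s : Bool) (k : ℤ × List ℤ) : ℤ × List ℤ :=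
  (0, (bif s then 1 else 0) :: k.1 :: k.2)

/-- The stack obtained from an arbitrary stack by pushing all symbols of a list, the head last. -/
def pushStacks (L : List Bool) (k : ℤ × List ℤ) : ℤ × List ℤ := L.foldr pushStack k

theorem pushStacks_cons (s : Bool) (L : List Bool) (k : ℤ × List ℤ) :
    pushStacks (s :: L) k = pushStack s (pushStacks L k) := rfl

theorem wordAct_pushWord (s : Bool) (k : ℤ × List ℤ) (n : ℕ) :
    wordAct (pushWord s) (k, n) = some (pushStack s k, n) := by
  cases s <;> simp [wordAct, pushWord, letterAct, pushStack]

theorem wordAct_popWord (s s' : Bool) (k : ℤ × List ℤ) (n : ℕ) :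
    wordAct (popWord s) (pushStack s' k, n) = if s = s' then some (k, n) else none := by
  cases s <;> cases s' <;> simp [wordAct, popWord, letterAct, pushStack]

theorem wordAct_stackWord (L : List Bool) (k : ℤ × List ℤ) (n : ℕ) :
    wordAct (stackWord L) (k, n) = some (pushStacks L k, n) := by
  induction L generalizing k with
  | nil => rfl
  | cons s L ih => simp [stackWord, wordAct_append, ih, wordAct_pushWord, pushStacks]

theorem wordAct_counterWord (z : ℤ) (k : ℤ × List ℤ) (n : ℕ) :
    wordAct (counterWord z) (k, n) = if 0 ≤ n + z then some (k, (n + z).toNat) else none := by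
  rw [counterWord]
  by_cases hz : z < 0
  · simp only [hz, decide_true]
    suffices ∀ m n : ℕ, wordAct (List.replicate m ((1 : Fin 3), true)) (k, n) =
        if m ≤ n then some (k, n - m) else none by
      rw [this]
      split_ifs <;> first | omega | rfl | (congr; omega)
    intro m
    induction m with
    | zero => simp [wordAct]
    | succ m ih =>
      intro n
      rcases n with _ | n
      · simp [List.replicate_succ, wordAct, letterAct]
      · simp [List.replicate_succ, wordAct, letterAct, ih]
  · simp only [hz, decide_false]
    suffices ∀ m n : ℕ, wordAct (List.replicate m ((1 : Fin 3), false)) (k, n) =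
        some (k, n + m) by
      rw [this, if_pos (by omega)]
      congr
      omega
    intro m
    induction m with
    | zero => simp [wordAct]
    | succ m ih =>
      intro n
      simp only [List.replicate_succ, wordAct, letterAct, Option.bind_some, ih]
      congr 2
      omega

theorem wordAct_word {v : List (Letter (Fin 3))} {z : ℤ} {k k' : ℤ × List ℤ} {n n' : ℕ}
    (hv : wordAct v (k, n) = some (k', n)) (hz : (n : ℤ) + z = n') :
    wordAct (Label.word (v, z)) (k, n) = some (k', n') := by
  simp only [Label.word, wordAct_append, hv, Option.bind_some, wordAct_counterWord]
  rw [if_pos (by omega), hz, Int.toNat_natCast]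

theorem eq_of_wordAct_word {v : List (Letter (Fin 3))} {z : ℤ} {k k' k₂ : ℤ × List ℤ} {n n₂ : ℕ}
    (hv : wordAct v (k, n) = some (k', n))
    (h : wordAct (Label.word (v, z)) (k, n) = some (k₂, n₂)) :
    k₂ = k' ∧ (n : ℤ) + z = n₂ := by
  simp only [Label.word, wordAct_append, hv, Option.bind_some, wordAct_counterWord] at h
  split_ifs at h with h0
  simp only [Option.some.injEq, Prod.mk.injEq] at h
  exact ⟨h.1.symm, by omega⟩

/-! ### Winning and losing configurations -/

namespace GameArena

variable {V Q : Type} {Γ : ValenceGraph V} {A : GameArena V Q}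

/-- The monoid element reached from `m` after the states in `w` and then `q`; the labels are
determined by the states, because there is at most one transition between two states. -/
noncomputable def track (Γ : ValenceGraph V) (A : GameArena V Q) (m : GraphMonoid Γ) :
    List Q → GraphMonoid Γ
  | [] => m
  | [_] => m
  | p :: q :: w => by
    classical
    exact track Γ A (if h : ∃ x, (p, x, q) ∈ A.δ then m * wordClass Γ h.choose else m) (q :: w)

theorem track_append (m : GraphMonoid Γ) (w : List Q) {p q : Q} {x : List (Letter V)}
    (h : (p, x, q) ∈ A.δ) :
    track Γ A m (w ++ [p, q]) = track Γ A m (w ++ [p]) * wordClass Γ x := by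
  induction w generalizing m with
  | nil =>
    have hex : ∃ x, (p, x, q) ∈ A.δ := ⟨x, h⟩
    simp only [List.nil_append, track, hex, dite_true]
    rw [A.transition_unique p q _ x hex.choose_spec h]
  | cons r w ih =>
    rcases w with _ | ⟨r', w⟩
    · simpa only [List.nil_append, List.cons_append, track] using ih _
    · simpa only [List.cons_append, track] using ih _

/-- The existential player wins if she can stay within a set of right-invertible configurations.
A strategy sees the history of states only, from which the monoid element is recomputed. -/
theorem wins_of_invariant (Inv : Conf Γ Q → Prop)
    (hR : ∀ c, Inv c → c.2 ∈ RInv (GraphMonoid Γ))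
    (hE : ∀ q m, Inv (q, m) → A.owner q = Player.existential →
      ∃ x q', (q, x, q') ∈ A.δ ∧ Inv (q', m * wordClass Γ x))
    (hU : ∀ q m x q', Inv (q, m) → A.owner q = Player.universal → (q, x, q') ∈ A.δ →
      Inv (q', m * wordClass Γ x))
    {q₀ : Q} {m₀ : GraphMonoid Γ} (h₀ : Inv (q₀, m₀)) :
    A.Wins (rightInvObjective Γ Q) Player.existential (q₀, m₀) := by
  classical
  have hch : ∀ (w : List Q) (q : Q), ∃ q', (∃ x, (q, x, q') ∈ A.δ) ∧
      (A.owner q = Player.existential → Inv (q, track Γ A m₀ (w ++ [q])) →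
        ∃ x, (q, x, q') ∈ A.δ ∧ Inv (q', track Γ A m₀ (w ++ [q]) * wordClass Γ x)) := by
    intro w q
    by_cases h : A.owner q = Player.existential ∧ Inv (q, track Γ A m₀ (w ++ [q]))
    · obtain ⟨x, q', hx, hI⟩ := hE q _ h.2 h.1
      exact ⟨q', ⟨x, hx⟩, fun _ _ => ⟨x, hx, hI⟩⟩
    · obtain ⟨x, q', hx⟩ := A.exists_transition q
      exact ⟨q', ⟨x, hx⟩, fun h1 h2 => absurd ⟨h1, h2⟩ h⟩
  choose next hlegal hnext using hch
  refine ⟨⟨next, fun w q _ => hlegal w q⟩, fun π hπ h0 hc => iff_of_true ?_ rfl⟩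
  have key : ∀ i,
      (π i).2 = track Γ A m₀ ((List.range (i + 1)).map fun j => (π j).1) ∧ Inv (π i) := by
    intro i
    induction i with
    | zero => simp [h0, track, h₀]
    | succ i ih =>
      obtain ⟨x, hx, hm⟩ := hπ i
      obtain ⟨ih1, ih2⟩ := ih
      have hr : ((List.range (i + 1 + 1)).map fun j => (π j).1) =
          ((List.range i).map fun j => (π j).1) ++ [(π i).1, (π (i + 1)).1] := by
        simp [List.range_succ]
      have hr' : ((List.range (i + 1)).map fun j => (π j).1) =
          ((List.range i).map fun j => (π j).1) ++ [(π i).1] := by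
        simp [List.range_succ]
      refine ⟨by rw [hr, track_append _ _ hx, hm, ih1, hr'], ?_⟩
      have hπ' : π (i + 1) = ((π (i + 1)).1, (π i).2 * wordClass Γ x) := Prod.ext rfl hm
      rw [hπ']
      rcases ho : A.owner (π i).1 with _ | _
      · have hci : next _ _ = _ := hc i ho
        rw [hr'] at ih1
        obtain ⟨x', hx', hI⟩ := hnext ((List.range i).map fun j => (π j).1) (π i).1 ho
          (by rw [← ih1]; exact ih2)
        rw [hci] at hx' hI
        rw [A.transition_unique _ _ _ _ hx hx', ih1]
        exact hI
      · exact hU _ _ x _ ih2 ho hx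
  exact fun i => hR _ (key i).2

/-- The configurations from which the universal player can force the play to leave the set of
right-invertible elements. -/
inductive Losing (Γ : ValenceGraph V) (A : GameArena V Q) : Conf Γ Q → Prop
  | bad {q : Q} {m : GraphMonoid Γ} (h : m ∉ RInv (GraphMonoid Γ)) : Losing Γ A (q, m)
  | univ {q : Q} {m : GraphMonoid Γ} {x : List (Letter V)} {q' : Q}
      (ho : A.owner q = Player.universal) (hx : (q, x, q') ∈ A.δ)
      (h : Losing Γ A (q', m * wordClass Γ x)) : Losing Γ A (q, m)
  | exist {q : Q} {m : GraphMonoid Γ} (ho : A.owner q = Player.existential)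
      (h : ∀ x q', (q, x, q') ∈ A.δ → Losing Γ A (q', m * wordClass Γ x)) : Losing Γ A (q, m)

/-- Every strategy has a compliant play from every configuration. -/
theorem exists_compliant_play (σ : A.Strategy Player.existential) (c₀ : Conf Γ Q) :
    ∃ π : ℕ → Conf Γ Q, A.IsPlay Γ π ∧ π 0 = c₀ ∧ Compliant σ π := by
  have hs : ∀ s : List Q × Conf Γ Q, ∃ c' : Conf Γ Q,
      (∃ x, (s.2.1, x, c'.1) ∈ A.δ ∧ c'.2 = s.2.2 * wordClass Γ x) ∧
      (A.owner s.2.1 = Player.existential → σ.next s.1 s.2.1 = c'.1) := by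
    rintro ⟨w, q, m⟩
    rcases ho : A.owner q with _ | _
    · obtain ⟨x, hx⟩ := σ.legal w q ho
      exact ⟨(_, m * wordClass Γ x), ⟨x, hx, rfl⟩, fun _ => rfl⟩
    · obtain ⟨x, q', hx⟩ := A.exists_transition q
      exact ⟨(q', m * wordClass Γ x), ⟨x, hx, rfl⟩, by simp⟩
  choose f hf1 hf2 using hs
  let step : List Q × Conf Γ Q → List Q × Conf Γ Q := fun s => (s.1 ++ [s.2.1], f s)
  let S : ℕ → List Q × Conf Γ Q := fun i => step^[i] ([], c₀)
  have hS : ∀ i, S (i + 1) = step (S i) := fun i => Function.iterate_succ_apply' step i _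
  have hw : ∀ i, (S i).1 = (List.range i).map fun j => (S j).2.1 := by
    intro i
    induction i with
    | zero => rfl
    | succ i ih => simp [hS, step, ih, List.range_succ]
  refine ⟨fun i => (S i).2, fun i => ?_, rfl, fun i ho => ?_⟩
  · simpa only [hS] using hf1 (S i)
  · simp only [← hw, hS]
    exact hf2 (S i) ho

/-- A play that is compliant with the residual strategy after the state `q` becomes compliant when
`(q, m)` is put in front of it. -/
theorem exists_play_of_step {σ : A.Strategy Player.existential} {q q' : Q} {m : GraphMonoid Γ}
    {x : List (Letter V)} (hx : (q, x, q') ∈ A.δ)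
    (hσ : A.owner q = Player.existential → σ.next [] q = q')
    (h : ∀ σ : A.Strategy Player.existential, ∃ π : ℕ → Conf Γ Q, A.IsPlay Γ π ∧
      π 0 = (q', m * wordClass Γ x) ∧ Compliant σ π ∧ π ∉ rightInvObjective Γ Q) :
    ∃ π : ℕ → Conf Γ Q, A.IsPlay Γ π ∧ π 0 = (q, m) ∧ Compliant σ π ∧
      π ∉ rightInvObjective Γ Q := by
  obtain ⟨π, hπ, h0, hc, hbad⟩ := h ⟨fun w => σ.next (q :: w), fun w => σ.legal (q :: w)⟩
  refine ⟨fun i => Nat.casesOn i (q, m) π, ?_, rfl, ?_, fun hgood => hbad fun i => hgood (i + 1)⟩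
  · rintro (_ | i)
    · exact ⟨x, by simpa [h0] using hx, by simp [h0]⟩
    · exact hπ i
  · rintro (_ | i) ho
    · simpa [h0] using hσ ho
    · have := hc i ho
      simpa [List.range_succ_eq_map, Function.comp_def] using this

theorem Losing.not_wins {c : Conf Γ Q} (h : Losing Γ A c) :
    ¬ A.Wins (rightInvObjective Γ Q) Player.existential c := by
  rintro ⟨σ, hσ⟩
  suffices ∀ σ : A.Strategy Player.existential, ∃ π : ℕ → Conf Γ Q, A.IsPlay Γ π ∧ π 0 = c ∧
      Compliant σ π ∧ π ∉ rightInvObjective Γ Q by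
    obtain ⟨π, h1, h2, h3, h4⟩ := this σ
    exact h4 ((hσ π h1 h2 h3).2 rfl)
  clear hσ σ
  induction h with
  | bad h =>
    intro σ
    obtain ⟨π, h1, h2, h3⟩ := exists_compliant_play σ (_, _)
    exact ⟨π, h1, h2, h3, fun hgood => h (by simpa [h2] using hgood 0)⟩
  | univ ho hx _ ih =>
    exact fun σ => exists_play_of_step hx (by simp [ho]) ih
  | exist ho _ ih =>
    intro σ
    obtain ⟨x, hx⟩ := σ.legal [] _ ho
    exact exists_play_of_step hx (fun _ => rfl) (ih x _ hx)

end GameArena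

/-! ### Arenas given by a partial labelling of pairs of states -/

section Labelled

/-- The transitions from `p` to `q` whenever `lab p q` is defined, where the states are numbered by
`e`. -/
def labelledTransitions {Q : Type} {N : ℕ} (e : Q ≃ Fin N) (lab : Q → Q → Option Label) :
    Finset (Fin N × List (Letter (Fin 3)) × Fin N) :=
  Finset.univ.biUnion fun pq : Fin N × Fin N =>
    ((lab (e.symm pq.1) (e.symm pq.2)).map fun ℓ => (pq.1, ℓ.word, pq.2)).toFinset

theorem mem_labelledTransitions {Q : Type} {N : ℕ} {e : Q ≃ Fin N} {lab : Q → Q → Option Label}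
    {p q : Fin N} {x : List (Letter (Fin 3))} : (p, x, q) ∈ labelledTransitions e lab ↔
      ∃ ℓ, lab (e.symm p) (e.symm q) = some ℓ ∧ ℓ.word = x := by
  constructor
  · intro h
    obtain ⟨⟨p', q'⟩, -, h⟩ := Finset.mem_biUnion.1 h
    obtain ⟨ℓ, hℓ, h⟩ := Option.map_eq_some_iff.1 (Option.mem_toFinset.1 h)
    simp only [Prod.mk.injEq] at h
    obtain ⟨rfl, rfl, rfl⟩ := h
    exact ⟨ℓ, hℓ, rfl⟩
  · rintro ⟨ℓ, hℓ, rfl⟩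
    exact Finset.mem_biUnion.2 ⟨(p, q), Finset.mem_univ _,
      Option.mem_toFinset.2 (Option.map_eq_some_iff.2 ⟨ℓ, hℓ, rfl⟩)⟩

variable {Q : Type} {N : ℕ} (e : Q ≃ Fin N) (owner : Q → Player) (lab : Q → Q → Option Label)
  (total : ∀ p, ∃ q, (lab p q).isSome) (init : Q)

/-- The arena on the states `0, …, N - 1`, numbered by `e`, with a transition from `p` to `q`
whenever `lab p q` is defined. -/
def labelledArena : GameArena (Fin 3) (Fin N) where
  owner p := owner (e.symm p)
  δ := labelledTransitions e lab
  init := e init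
  exists_transition p := by
    obtain ⟨q, hq⟩ := total (e.symm p)
    obtain ⟨ℓ, hℓ⟩ := Option.isSome_iff_exists.1 hq
    exact ⟨ℓ.word, e q, mem_labelledTransitions.2 ⟨ℓ, by simpa using hℓ, rfl⟩⟩
  transition_unique p q x y hx hy := by
    obtain ⟨ℓ, h, rfl⟩ := mem_labelledTransitions.1 hx
    obtain ⟨ℓ', h', rfl⟩ := mem_labelledTransitions.1 hy
    rw [Option.some.inj (h.symm.trans h')]

variable {e owner lab total init}

theorem mem_labelledArena {p q : Fin N} {x : List (Letter (Fin 3))} :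
    (p, x, q) ∈ (labelledArena e owner lab total init).δ ↔
      ∃ ℓ, lab (e.symm p) (e.symm q) = some ℓ ∧ ℓ.word = x :=
  mem_labelledTransitions

/-- `wins_of_invariant` for invariants on stack contents and counter values. -/
theorem labelledArena_wins {Γ : ValenceGraph (Fin 3)} (W : Q → List Bool → ℕ → Prop)
    (hE : ∀ q L n, W q L n → owner q = Player.existential → ∃ q' ℓ L' n', lab q q' = some ℓ ∧
      storeElem Γ L n * wordClass Γ ℓ.word = storeElem Γ L' n' ∧ W q' L' n')
    (hU : ∀ q L n q' ℓ, W q L n → owner q = Player.universal → lab q q' = some ℓ → ∃ L' n',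
      storeElem Γ L n * wordClass Γ ℓ.word = storeElem Γ L' n' ∧ W q' L' n')
    (h₀ : W init [] 0) :
    (labelledArena e owner lab total init).Wins (rightInvObjective Γ (Fin N)) Player.existential
      ((labelledArena e owner lab total init).init, 1) := by
  refine GameArena.wins_of_invariant
    (fun c => ∃ L n, c.2 = storeElem Γ L n ∧ W (e.symm c.1) L n) ?_ ?_ ?_ ?_
  · rintro c ⟨L, n, h, -⟩
    rw [h]
    exact storeElem_mem_RInv L n
  · rintro q m ⟨L, n, rfl, hW⟩ ho
    obtain ⟨q', ℓ, L', n', hℓ, hm, hW'⟩ := hE _ L n hW ho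
    exact ⟨ℓ.word, e q', mem_labelledArena.2 ⟨ℓ, by simpa using hℓ, rfl⟩, L', n', hm,
      by simpa using hW'⟩
  · rintro q m x q' ⟨L, n, rfl, hW⟩ ho hx
    obtain ⟨ℓ, hℓ, rfl⟩ := mem_labelledArena.1 hx
    exact hU _ L n _ ℓ hW ho hℓ
  · exact ⟨[], 0, storeElem_nil_zero.symm, by simpa [labelledArena] using h₀⟩

variable (e owner lab total init) in
/-- The universal player wins from the state `q` whenever a word leads from the empty storage to
the storage contents `z`. -/
def LosesAt (Γ : ValenceGraph (Fin 3)) (q : Q) (z : Store) : Prop :=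
  ∀ w, wordAct w ((0, []), 0) = some z →
    GameArena.Losing Γ (labelledArena e owner lab total init) (e q, wordClass Γ w)

variable {Γ : ValenceGraph (Fin 3)}

theorem LosesAt.univ {q q' : Q} {z z' : Store} {ℓ : Label} (ho : owner q = Player.universal)
    (hℓ : lab q q' = some ℓ) (hz : wordAct ℓ.word z = some z')
    (h : LosesAt e owner lab total init Γ q' z') : LosesAt e owner lab total init Γ q z := by
  intro w hw
  refine .univ (by simpa [labelledArena] using ho) (x := ℓ.word) (q' := e q')
    (mem_labelledArena.2 ⟨ℓ, by simpa using hℓ, rfl⟩) ?_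
  rw [← wordClass_append]
  exact h _ (by simp [wordAct_append, hw, hz])

theorem LosesAt.exist (hΓ : Γ ⊆ graphIV) {q : Q} {z : Store} (ho : owner q = Player.existential)
    (h : ∀ q' ℓ z', lab q q' = some ℓ → wordAct ℓ.word z = some z' →
      LosesAt e owner lab total init Γ q' z') : LosesAt e owner lab total init Γ q z := by
  intro w hw
  refine .exist (by simpa [labelledArena] using ho) fun x q' hx => ?_
  obtain ⟨ℓ, hℓ, rfl⟩ := mem_labelledArena.1 hx
  rw [← wordClass_append]
  have hact : wordAct (w ++ ℓ.word) ((0, []), 0) = wordAct ℓ.word z := by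
    simp [wordAct_append, hw]
  rcases hz : wordAct ℓ.word z with _ | z'
  · exact .bad (notMem_RInv_of_wordAct_eq_none hΓ (hact.trans hz))
  · simpa using h (e.symm q') ℓ z' (by simpa using hℓ) hz _ (hact.trans hz)

theorem LosesAt.not_wins (hΓ : Γ ⊆ graphIV)
    (h : ∀ z, LosesAt e owner lab total init Γ init z) (w : List (Letter (Fin 3))) :
    ¬ (labelledArena e owner lab total init).Wins (rightInvObjective Γ (Fin N))
      Player.existential ((labelledArena e owner lab total init).init, wordClass Γ w) := by
  refine GameArena.Losing.not_wins ?_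
  rcases hz : wordAct w ((0, []), 0) with _ | z
  · exact .bad (notMem_RInv_of_wordAct_eq_none hΓ hz)
  · exact h z w hz

end Labelled

/-! ### Counter machines -/

/-- The operations on a counter: do nothing, add one, subtract one, check that it is zero. -/
inductive OpKind
  | nop
  | inc
  | dec
  | zero

/-- The number added to the counter by an operation. -/
def OpKind.sign : OpKind → ℤ
  | nop => 0
  | inc => 1
  | dec => -1
  | zero => 0

/-- The operation `κ` on counter `i` leads from the counter values `x` to the values `y`. A
decrement of an empty counter leads nowhere. -/
def OpKind.Step (κ : OpKind) (i : ℕ) (x y : ℕ → ℕ) : Prop :=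
  (∀ j, (y j : ℤ) = x j + if j = i then κ.sign else 0) ∧ (κ = .zero → x i = 0)

/-- A nondeterministic counter machine. Counters are numbered by natural numbers, but only those
below `numRegs` are used. -/
structure CounterMachine where
  State : Type
  Trans : Type
  [fintypeState : Fintype State]
  [fintypeTrans : Fintype Trans]
  start : State
  final : State
  src : Trans → State
  tgt : Trans → State
  kind : Trans → OpKind
  reg : Trans → ℕ
  numRegs : ℕ
  numRegs_pos : 0 < numRegs
  reg_lt : ∀ t, reg t < numRegs

namespace CounterMachine

attribute [instance] fintypeState fintypeTrans

variable (M : CounterMachine)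

/-- One step of a counter machine. -/
def Step (c d : M.State × (ℕ → ℕ)) : Prop :=
  ∃ t, M.src t = c.1 ∧ M.tgt t = d.1 ∧ (M.kind t).Step (M.reg t) c.2 d.2

/-- Some run from the start state with counter values `x` reaches the final state. -/
def Halts (x : ℕ → ℕ) : Prop :=
  ∃ y, Relation.ReflTransGen M.Step (M.start, x) (M.final, y)

/-- The change of counter `j` in the transition `t`. -/
def delta (t : M.Trans) (j : ℕ) : ℤ := if j = M.reg t then (M.kind t).sign else 0

end CounterMachine

/-! ### Blocks of the stack -/

/-- The stack contents describing the counters `j, …, j + m - 1`: each value in unary with the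
symbol `false`, followed by the delimiter `true`; counter `j` is on top. -/
def block (x : ℕ → ℕ) : ℕ → ℕ → List Bool
  | _, 0 => []
  | j, m + 1 => List.replicate (x j) false ++ true :: block x (j + 1) m

/-- The sum of the counters `j, …, j + m - 1`, weighted by `w`. -/
def weightedSum (w : ℕ → ℤ) (x : ℕ → ℕ) : ℕ → ℕ → ℤ
  | _, 0 => 0
  | j, m + 1 => w j * x j + weightedSum w x (j + 1) m

theorem block_congr {x y : ℕ → ℕ} {j m : ℕ} (h : ∀ i, j ≤ i → i < j + m → x i = y i) :
    block x j m = block y j m := by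
  induction m generalizing j with
  | zero => rfl
  | succ m ih =>
    rw [block, block, h j le_rfl (by omega), ih fun i hi hi' => h i (by omega) (by omega)]

theorem weightedSum_congr {w : ℕ → ℤ} {x y : ℕ → ℕ} {j m : ℕ}
    (h : ∀ i, j ≤ i → i < j + m → x i = y i) : weightedSum w x j m = weightedSum w y j m := by
  induction m generalizing j with
  | zero => rfl
  | succ m ih =>
    rw [weightedSum, weightedSum, h j le_rfl (by omega),
      ih fun i hi hi' => h i (by omega) (by omega)]

theorem weightedSum_eq_sum (w : ℕ → ℤ) (x : ℕ → ℕ) (j m : ℕ) :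
    weightedSum w x j m = ∑ i ∈ Finset.range m, w (j + i) * x (j + i) := by
  induction m generalizing j with
  | zero => rfl
  | succ m ih =>
    rw [weightedSum, ih, Finset.sum_range_succ', add_comm]
    simp only [add_assoc, add_comm 1, add_zero]

theorem weightedSum_nonpos {w : ℕ → ℤ} (hw : ∀ i, w i ≤ 0) (x : ℕ → ℕ) (j m : ℕ) :
    weightedSum w x j m ≤ 0 := by
  rw [weightedSum_eq_sum]
  exact Finset.sum_nonpos fun i _ => mul_nonpos_of_nonpos_of_nonneg (hw _) (by positivity)

/-! ### The simulation game -/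

/-- The states of the game for a counter machine. At `main s` the universal player chooses a
transition `t`, and at `push t j` he pushes the values which he claims the counters to have after
`t`, down to counter `j`. At `choice t` the existential player accepts or makes a complaint about
counter `i`, that its new value is too small (`(i, false)`) or too large (`(i, true)`). The
complaint is examined in the states `pop p t c j`, where the new block (`p = false`) and the old one
(`p = true`) are popped. -/
inductive GameState (M : CounterMachine)
  | start
  | main (s : M.State)
  | push (t : M.Trans) (j : Fin (M.numRegs + 1))
  | choice (t : M.Trans)
  | pop (p : Bool) (t : M.Trans) (c : Fin M.numRegs × Bool) (j : Fin (M.numRegs + 1))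
  | halt

namespace GameState

variable (M : CounterMachine)

instance : Finite (GameState M) := by
  let f : GameState M → Option (M.State ⊕ (M.Trans × Fin (M.numRegs + 1)) ⊕ Option M.Trans ⊕
      (Bool × M.Trans × (Fin M.numRegs × Bool) × Fin (M.numRegs + 1)))
    | start => none
    | main s => some (.inl s)
    | push t j => some (.inr (.inl (t, j)))
    | choice t => some (.inr (.inr (.inl (some t))))
    | pop p t c j => some (.inr (.inr (.inr (p, t, c, j))))
    | halt => some (.inr (.inr (.inl none)))
  refine Finite.of_injective f fun a b h => ?_
  cases a <;> cases b <;> simp_all [f]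

variable {M}

/-- The existential player owns the states that deal with complaints. -/
def owner : GameState M → Player
  | start => .universal
  | main _ => .universal
  | push _ _ => .universal
  | choice _ => .existential
  | pop _ _ _ _ => .existential
  | halt => .existential

/-- The amount added to `b` for each unit popped from counter `i` of the new block (`p = false`)
or of the old block (`p = true`), when the complaint `c` about the transition `t` is examined. Every
unit of an old counter costs one, up to a correction for the counter complained about. If the
transition claims this counter to be zero, its new value is compared with zero instead of the old
value. `complaint_total` gives the effect of these amounts. -/
noncomputable def weight (p : Bool) (t : M.Trans) (c : Fin M.numRegs × Bool) (i : ℕ) : ℤ :=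
  if p then
    -1 + if i = (c.1 : ℕ) then
      (if c.2 then (open Classical in if M.kind t = .zero ∧ M.reg t = i then 0 else -1) else 1)
      else 0
  else if i = (c.1 : ℕ) then (if c.2 then 1 else -1) else 0

/-- The amount added to `b` at the end of the examination of a complaint. -/
def finish (t : M.Trans) (c : Fin M.numRegs × Bool) : ℤ :=
  (if c.2 then - M.delta t c.1 else M.delta t c.1) - 1

open Classical in
/-- The transitions of the game for the machine `M` with initial counter values `x₀`. -/
noncomputable def lab (x₀ : ℕ → ℕ) : GameState M → GameState M → Option Label
  | start, main s => if s = M.start then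
      some (stackWord (block x₀ 0 M.numRegs), weightedSum 1 x₀ 0 M.numRegs) else none
  | main s, push t j => if M.src t = s ∧ (j : ℕ) = M.numRegs then some ([], 0) else none
  | main s, halt => if s = M.final then some ([], 0) else none
  | main _, start => some ([], 0)
  | push t j, push t' j' => if t = t' then
      (if (j' : ℕ) + 1 = j then some (pushWord true, 0)
        else if j = j' ∧ (j : ℕ) < M.numRegs then some (pushWord false, 0) else none) else none
  | push t j, choice t' => if t = t' ∧ (j : ℕ) = 0 then some ([], 0) else none
  | choice t, main s => if s = M.tgt t then some ([], (M.kind t).sign) else none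
  | choice t, pop p t' _ j => if p = false ∧ t = t' ∧ (j : ℕ) = 0 then some ([], 0) else none
  | pop p t c j, pop p' t' c' j' => if t = t' ∧ c = c' then
      (if p = p' then
        (if (j' : ℕ) = j + 1 then some (popWord true, 0)
          else if j = j' ∧ (j : ℕ) < M.numRegs then some (popWord false, weight p t c j) else none)
        else if p = false ∧ (j : ℕ) = M.numRegs ∧ (j' : ℕ) = 0 then some ([], 0) else none)
      else none
  | pop p t c j, start => if p = true ∧ (j : ℕ) = M.numRegs then some ([], finish t c) else none
  | halt, halt => some ([], -1)
  | _, _ => none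

theorem exists_lab (x₀ : ℕ → ℕ) (p : GameState M) : ∃ q, (lab x₀ p q).isSome := by
  rcases p with _ | s | ⟨t, j⟩ | t | ⟨p, t, c, j⟩ | _
  · exact ⟨main M.start, by simp [lab]⟩
  · exact ⟨start, by simp [lab]⟩
  · obtain ⟨_ | j, hj⟩ := j
    · exact ⟨choice t, by simp [lab]⟩
    · exact ⟨push t ⟨j, by omega⟩, by simp [lab]⟩
  · exact ⟨main (M.tgt t), by simp [lab]⟩
  · by_cases hj : (j : ℕ) = M.numRegs
    · cases p
      · exact ⟨pop true t c 0, by simp [lab, hj]⟩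
      · exact ⟨start, by simp [lab, hj]⟩
    · exact ⟨pop p t c ⟨j + 1, by omega⟩, by simp [lab]⟩
  · exact ⟨halt, by simp [lab]⟩

/-- The change of the surplus of `b` over the sum of the counters `x` when the complaint `(i, d)`
about the new values `y` is examined. -/
theorem complaint_total (t : M.Trans) (i : Fin M.numRegs) (d : Bool) (x y : ℕ → ℕ) :
    weightedSum (weight false t (i, d)) y 0 M.numRegs +
      (weightedSum (weight true t (i, d)) x 0 M.numRegs + finish t (i, d)) +
      weightedSum 1 x 0 M.numRegs =
    if d then y i - 1 - M.delta t i -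
      (open Classical in if M.kind t = .zero ∧ M.reg t = i then 0 else (x i : ℤ))
    else x i + M.delta t i - 1 - y i := by
  classical
  have hi : (i : ℕ) < M.numRegs := i.2
  simp only [weightedSum_eq_sum, weight, finish, zero_add, add_mul, Finset.sum_add_distrib,
    Pi.one_apply, if_true, ite_mul, Bool.false_eq_true, if_false, zero_mul, Finset.sum_ite_eq',
    Finset.mem_range, hi, neg_mul, one_mul, Finset.sum_neg_distrib]
  cases d
  · simp
    ring
  · split_ifs <;> ring

theorem weight_nonneg_or_nonpos (p : Bool) (t : M.Trans) (c : Fin M.numRegs × Bool) :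
    (∀ i, 0 ≤ weight p t c i) ∨ (∀ i, weight p t c i ≤ 0) := by
  cases p
  · cases hc : c.2
    · exact .inr fun i => by simp only [weight, hc]; grind
    · exact .inl fun i => by simp only [weight, hc]; grind
  · exact .inr fun i => by simp only [weight]; grind

theorem weight_true_nonpos (t : M.Trans) (c : Fin M.numRegs × Bool) (i : ℕ) :
    weight true t c i ≤ 0 := by
  simp only [weight]; grind

theorem finish_nonpos (t : M.Trans) (c : Fin M.numRegs × Bool) : finish t c ≤ 0 := by
  simp only [finish, CounterMachine.delta]
  cases M.kind t <;> simp [OpKind.sign] <;> grind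

variable {M : CounterMachine} {x₀ : ℕ → ℕ} {Γ : ValenceGraph (Fin 3)}

/-! ### The existential player wins if the machine does not halt -/

/-- The invariant maintained by the existential player: the topmost block holds counter values that
are reached by a run of the machine, and their sum is at most the value of `b`; while a complaint is
examined, the value of `b` suffices for the rest of the examination. -/
def Inv (M : CounterMachine) (x₀ : ℕ → ℕ) : GameState M → List Bool → ℕ → Prop
  | start, _, _ => True
  | halt, _, _ => False
  | main s, L, n => ∃ x L₀, Relation.ReflTransGen M.Step (M.start, x₀) (s, x) ∧
      L = block x 0 M.numRegs ++ L₀ ∧ weightedSum 1 x 0 M.numRegs ≤ n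
  | push t j, L, n => ∃ x y L₀ m, Relation.ReflTransGen M.Step (M.start, x₀) (M.src t, x) ∧
      (j : ℕ) + m = M.numRegs ∧ L = block y j m ++ (block x 0 M.numRegs ++ L₀) ∧
      weightedSum 1 x 0 M.numRegs ≤ n
  | choice t, L, n => ∃ x y L₀, Relation.ReflTransGen M.Step (M.start, x₀) (M.src t, x) ∧
      L = block y 0 M.numRegs ++ (block x 0 M.numRegs ++ L₀) ∧
      weightedSum 1 x 0 M.numRegs ≤ n
  | pop p t c j, L, n => ∃ y L₁ m z, (j : ℕ) + m = M.numRegs ∧ L = block y j m ++ L₁ ∧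
      0 ≤ n + weightedSum (weight p t c) y j m + z ∧
      if p then z = finish t c else ∃ x L₀, L₁ = block x 0 M.numRegs ++ L₀ ∧
        z = weightedSum (weight true t c) x 0 M.numRegs + finish t c

theorem weightedSum_one_nonneg (x : ℕ → ℕ) (j m : ℕ) : 0 ≤ weightedSum 1 x j m := by
  rw [weightedSum_eq_sum]
  exact Finset.sum_nonneg fun i _ => by simp

theorem weightedSum_one_of_step {t : M.Trans} {x y : ℕ → ℕ}
    (h : (M.kind t).Step (M.reg t) x y) :
    weightedSum 1 y 0 M.numRegs = weightedSum 1 x 0 M.numRegs + (M.kind t).sign := by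
  simp [weightedSum_eq_sum, h.1, Finset.sum_add_distrib, M.reg_lt t]

/-- If the new values in the topmost block are wrong then some complaint is justified. -/
theorem exists_complaint (t : M.Trans) (x y : ℕ → ℕ)
    (h : ¬ ∃ x', (M.kind t).Step (M.reg t) x x' ∧ ∀ i < M.numRegs, x' i = y i) :
    ∃ c, 0 ≤ weightedSum 1 x 0 M.numRegs + weightedSum (weight false t c) y 0 M.numRegs +
      (weightedSum (weight true t c) x 0 M.numRegs + finish t c) := by
  by_contra! hc
  have hlow : ∀ i < M.numRegs, (x i : ℤ) + M.delta t i ≤ y i := by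
    intro i hi
    have h1 := complaint_total t ⟨i, hi⟩ false x y
    have h2 := hc (⟨i, hi⟩, false)
    simp only [Bool.false_eq_true, if_false] at h1
    omega
  have hup : ∀ i < M.numRegs, (y i : ℤ) ≤ M.delta t i +
      (open Classical in if M.kind t = .zero ∧ M.reg t = i then 0 else (x i : ℤ)) := by
    intro i hi
    have h1 := complaint_total t ⟨i, hi⟩ true x y
    have h2 := hc (⟨i, hi⟩, true)
    simp only [if_true] at h1
    omega
  have hr := M.reg_lt t
  have hlow' := hlow _ hr
  have hup' := hup _ hr
  refine h ⟨fun j => if j = M.reg t then y j else x j, ⟨fun j => ?_, fun hz => ?_⟩,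
    fun i hi => ?_⟩
  · dsimp only
    split_ifs with hj
    · subst hj
      simp only [CounterMachine.delta, if_true, and_true] at hlow' hup'
      split_ifs at hup' with hz
      · rw [hz.1] at hlow' hup' ⊢
        simp only [OpKind.sign] at hlow' hup' ⊢
        omega
      · omega
    · simp
  · simp only [CounterMachine.delta, hz, if_true, and_self, OpKind.sign] at hlow' hup'
    omega
  · dsimp only
    split_ifs with hj
    · rfl
    · have h1 := hlow i hi
      have h2 := hup i hi
      simp only [CounterMachine.delta, if_neg hj] at h1 h2
      rw [if_neg fun h => hj h.2.symm] at h2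
      omega

section Inv

variable (h₁ : s(0, 1) ∈ Γ) (h₂ : s(1, 2) ∈ Γ)
include h₁ h₂

theorem storeElem_mul_counter {L : List Bool} {n n' : ℕ} {z : ℤ} (hz : (n : ℤ) + z = n') :
    storeElem Γ L n * wordClass Γ (Label.word ([], z)) = storeElem Γ L n' :=
  storeElem_mul_word h₁ h₂ (by simp) (by simp) hz

theorem storeElem_mul_push {L : List Bool} {n : ℕ} {s : Bool} :
    storeElem Γ L n * wordClass Γ (Label.word (pushWord s, 0)) = storeElem Γ (s :: L) n :=
  storeElem_mul_word h₁ h₂ (fun x hx => (forall_mem_stackWord [s] x (by simpa [stackWord])).1)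
    (stackWord_append_pushWord s L) (by simp)

theorem storeElem_mul_pop {L : List Bool} {n n' : ℕ} {s : Bool} {z : ℤ} (hz : (n : ℤ) + z = n') :
    storeElem Γ (s :: L) n * wordClass Γ (Label.word (popWord s, z)) = storeElem Γ L n' :=
  storeElem_mul_word h₁ h₂ ne_one_of_mem_popWord (stackWord_cons_append_popWord s L) hz

/-- At a state of the universal player every transition keeps the invariant. -/
theorem Inv.universal (hM : ¬ M.Halts x₀) {q q' : GameState M} {L : List Bool} {n : ℕ} {ℓ : Label}
    (hI : Inv M x₀ q L n) (ho : owner q = .universal) (hℓ : lab x₀ q q' = some ℓ) :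
    ∃ L' n', storeElem Γ L n * wordClass Γ ℓ.word = storeElem Γ L' n' ∧ Inv M x₀ q' L' n' := by
  rcases q with _ | s | ⟨t, j⟩ | t | ⟨p, t, c, j⟩ | _
  · rcases q' with _ | s' | _ | _ | _ | _ <;> simp only [lab, reduceCtorEq] at hℓ
    split_ifs at hℓ with hs
    obtain rfl := Option.some.inj hℓ
    have h0 := weightedSum_one_nonneg x₀ 0 M.numRegs
    refine ⟨block x₀ 0 M.numRegs ++ L, n + (weightedSum 1 x₀ 0 M.numRegs).toNat,
      storeElem_mul_word h₁ h₂ (fun x hx => (forall_mem_stackWord _ x hx).1)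
        (by rw [stackWord_append]) (by push_cast; omega), x₀, L, by rw [hs], rfl, by omega⟩
  · rcases q' with _ | s' | ⟨t, j⟩ | _ | _ | _ <;> simp only [lab, reduceCtorEq] at hℓ
    · obtain rfl := Option.some.inj hℓ
      exact ⟨L, n, storeElem_mul_counter h₁ h₂ (by simp), trivial⟩
    · split_ifs at hℓ with hs
      obtain rfl := Option.some.inj hℓ
      obtain ⟨rfl, hj⟩ := hs
      obtain ⟨x, L₀, hr, rfl, hn⟩ := hI
      exact ⟨_, n, storeElem_mul_counter h₁ h₂ (by simp), x, x, L₀, 0, hr, by omega,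
        by simp [block], hn⟩
    · split_ifs at hℓ with hs
      obtain ⟨x, L₀, hr, -, -⟩ := hI
      exact absurd ⟨x, hs ▸ hr⟩ hM
  · obtain ⟨x, y, L₀, m, hr, hj, rfl, hn⟩ := hI
    rcases q' with _ | s' | ⟨t', j'⟩ | t' | _ | _ <;> simp only [lab, reduceCtorEq] at hℓ
    · split_ifs at hℓ with ht hj' hj' <;> obtain rfl := Option.some.inj hℓ <;> subst ht
      · refine ⟨_, n, storeElem_mul_push h₁ h₂, x, Function.update y j' 0, L₀, m + 1, hr,
          by omega, ?_, hn⟩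
        rw [block, Function.update_self, hj',
          block_congr (x := Function.update y j' 0) (y := y)]
        · simp
        · intro i hi _
          rw [Function.update_of_ne (by omega)]
      · obtain ⟨rfl, hj'⟩ := hj'
        obtain ⟨m, rfl⟩ : ∃ m', m = m' + 1 := ⟨m - 1, by omega⟩
        refine ⟨_, n, storeElem_mul_push h₁ h₂, x, Function.update y j (y j + 1), L₀, m + 1, hr,
          by omega, ?_, hn⟩
        rw [block, block, Function.update_self,
          block_congr (x := Function.update y j (y j + 1)) (y := y)]
        · simp [List.replicate_succ]
        · intro i hi _
          rw [Function.update_of_ne (by omega)]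
    · split_ifs at hℓ with ht
      obtain rfl := Option.some.inj hℓ
      obtain ⟨rfl, hj0⟩ := ht
      refine ⟨_, n, storeElem_mul_counter h₁ h₂ (by simp), x, y, L₀, hr, ?_, hn⟩
      rw [hj0, show m = M.numRegs by omega]
  all_goals simp [owner] at ho

/-- At a state of the existential player some transition keeps the invariant. -/
theorem Inv.existential {q : GameState M} {L : List Bool} {n : ℕ}
    (hI : Inv M x₀ q L n) (ho : owner q = .existential) : ∃ q' ℓ L' n', lab x₀ q q' = some ℓ ∧
      storeElem Γ L n * wordClass Γ ℓ.word = storeElem Γ L' n' ∧ Inv M x₀ q' L' n' := by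
  rcases q with _ | s | ⟨t, j⟩ | t | ⟨p, t, c, j⟩ | _
  · simp [owner] at ho
  · simp [owner] at ho
  · simp [owner] at ho
  · obtain ⟨x, y, L₀, hr, rfl, hn⟩ := hI
    by_cases h : ∃ x', (M.kind t).Step (M.reg t) x x' ∧ ∀ i < M.numRegs, x' i = y i
    · obtain ⟨x', hs, hx'⟩ := h
      have hsum := weightedSum_one_of_step hs
      have h0 := weightedSum_one_nonneg x' 0 M.numRegs
      refine ⟨main (M.tgt t), ([], (M.kind t).sign), _, (n + (M.kind t).sign).toNat, by simp [lab],
        storeElem_mul_counter h₁ h₂ (by omega), x', block x 0 M.numRegs ++ L₀,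
        hr.tail ⟨t, rfl, rfl, hs⟩, ?_, by omega⟩
      rw [block_congr (x := x') (y := y) fun i _ hi => hx' i (by omega)]
    · obtain ⟨c, hc⟩ := exists_complaint t x y h
      exact ⟨pop false t c 0, ([], 0), _, n, by simp [lab], storeElem_mul_counter h₁ h₂ (by simp),
        y, _, M.numRegs, _, by simp, rfl, by rw [Fin.val_zero]; omega, x, L₀, rfl, rfl⟩
  · obtain ⟨y, L₁, m, z, hj, rfl, hn, hz⟩ := hI
    rcases m with _ | m
    · rw [weightedSum] at hn
      rcases p with _ | _
      · obtain ⟨x, L₀, rfl, rfl⟩ := hz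
        refine ⟨pop true t c 0, ([], 0), _, n, by simp [lab]; omega,
          storeElem_mul_counter h₁ h₂ (by simp), x, L₀, M.numRegs, _, by simp, ?_, ?_, rfl⟩
        · simp [block]
        · rw [Fin.val_zero]
          omega
      · rw [if_pos rfl] at hz
        exact ⟨start, ([], finish t c), _, (n + finish t c).toNat, by simp [lab]; omega,
          storeElem_mul_counter h₁ h₂ (by omega), trivial⟩
    · rcases hy : y j with _ | a
      · refine ⟨pop p t c ⟨j + 1, by omega⟩, (popWord true, 0), block y (j + 1) m ++ L₁, n,
          by simp [lab], ?_, y, L₁, m, z, by simp; omega, rfl, ?_, hz⟩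
        · simpa [block, hy] using storeElem_mul_pop h₁ h₂ (by simp)
        · simpa [weightedSum, hy] using hn
      · have hzn : z ≤ 0 := by
          cases p
          · obtain ⟨x, L₀, rfl, rfl⟩ := hz
            exact add_nonpos (weightedSum_nonpos (weight_true_nonpos t c) _ _ _)
              (finish_nonpos t c)
          · rw [if_pos rfl] at hz
            exact hz ▸ finish_nonpos t c
        have hcongr : ∀ i, (j : ℕ) + 1 ≤ i → i < j + 1 + m → Function.update y j a i = y i :=
          fun i hi _ => Function.update_of_ne (by omega) _ _
        rw [weightedSum, hy] at hn
        push_cast at hn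
        -- All amounts still to be added have the sign of the present one, or are negative.
        have hpos : 0 ≤ n + weight p t c j := by
          rcases weight_nonneg_or_nonpos p t c with hw | hw
          · have := hw j
            omega
          · have h3 := weightedSum_nonpos hw y (j + 1) m
            have h4 := mul_nonpos_of_nonpos_of_nonneg (hw j) (Int.natCast_nonneg a)
            linarith
        refine ⟨pop p t c j, (popWord false, weight p t c j),
          block (Function.update y j a) j (m + 1) ++ L₁, (n + weight p t c j).toNat,
          by simp [lab]; omega, ?_, _, L₁, m + 1, z, hj, rfl, ?_, hz⟩
        · rw [block, block, hy, Function.update_self, block_congr hcongr]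
          exact storeElem_mul_pop h₁ h₂ (by omega)
        · rw [weightedSum, Function.update_self, weightedSum_congr hcongr]
          rw [Int.toNat_of_nonneg hpos]
          linarith
  · exact hI.elim

end Inv

/-! ### The universal player wins if the machine halts -/

section Lose

variable {N : ℕ} {e : GameState M ≃ Fin N} (hΓ : Γ ⊆ graphIV)

/-- The universal player wins from the given state and storage contents. -/
def LosesFrom (Γ : ValenceGraph (Fin 3)) (e : GameState M ≃ Fin N) (x₀ : ℕ → ℕ) (q : GameState M)
    (K : ℤ × List ℤ) (n : ℕ) : Prop :=
  LosesAt e owner (lab x₀) (exists_lab x₀) start Γ q (K, n)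

theorem LosesFrom.univ {q q' : GameState M} {K K' : ℤ × List ℤ} {n n' : ℕ}
    {v : List (Letter (Fin 3))} {z : ℤ} (ho : owner q = .universal) (hℓ : lab x₀ q q' = some (v, z))
    (hv : wordAct v (K, n) = some (K', n)) (hz : (n : ℤ) + z = n')
    (h : LosesFrom Γ e x₀ q' K' n') : LosesFrom Γ e x₀ q K n :=
  LosesAt.univ ho hℓ (wordAct_word hv hz) h

include hΓ in
theorem losesFrom_halt (K : ℤ × List ℤ) (n : ℕ) : LosesFrom Γ e x₀ halt K n := by
  induction n with
  | zero =>
    refine LosesAt.exist hΓ rfl fun q' ℓ z' hℓ hz => ?_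
    cases q' <;> simp only [lab, reduceCtorEq] at hℓ
    obtain rfl := Option.some.inj hℓ
    have := eq_of_wordAct_word (k' := K) rfl hz
    omega
  | succ n ih =>
    refine LosesAt.exist hΓ rfl fun q' ℓ z' hℓ hz => ?_
    cases q' <;> simp only [lab, reduceCtorEq] at hℓ
    obtain rfl := Option.some.inj hℓ
    obtain ⟨K', n'⟩ := z'
    obtain ⟨rfl, h⟩ := eq_of_wordAct_word (k' := K) rfl hz
    obtain rfl : n' = n := by omega
    exact ih

/-- While a block is popped, the existential player has no choice. -/
theorem losesFrom_pop (hΓ : Γ ⊆ graphIV) {p : Bool} {t : M.Trans} {c : Fin M.numRegs × Bool}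
    {y : ℕ → ℕ} {K : ℤ × List ℤ} (m : ℕ) (j : Fin (M.numRegs + 1)) (n : ℕ)
    (hj : (j : ℕ) + m = M.numRegs)
    (h : ∀ n' : ℕ, (n' : ℤ) = n + weightedSum (weight p t c) y j m →
      LosesFrom Γ e x₀ (pop p t c (Fin.last _)) K n') :
    LosesFrom Γ e x₀ (pop p t c j) (pushStacks (block y j m) K) n := by
  induction m generalizing j n with
  | zero =>
    obtain rfl : j = Fin.last _ := Fin.ext (by simpa using hj)
    exact h n (by simp [weightedSum])
  | succ m ih =>
    rw [block]
    rw [weightedSum] at h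
    generalize y j = a at h
    induction a generalizing n with
    | zero =>
      refine LosesAt.exist hΓ rfl fun q' ℓ z' hℓ hz => ?_
      obtain ⟨K', n'⟩ := z'
      rcases q' with _ | s | ⟨t', j'⟩ | t' | ⟨p', t', c', j'⟩ | _ <;>
        simp only [lab, reduceCtorEq] at hℓ
      · split_ifs at hℓ; omega
      · simp only [List.replicate_zero, List.nil_append, pushStacks_cons] at hz
        split_ifs at hℓ with h1 h2 h3 h3 h3
        · obtain rfl := Option.some.inj hℓ
          obtain ⟨rfl, rfl⟩ := h1
          subst h2
          obtain ⟨rfl, hn⟩ := eq_of_wordAct_word (by rw [wordAct_popWord, if_pos rfl]) hz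
          obtain rfl : n' = n := by omega
          rw [← h3]
          refine ih j' n' (by omega) fun n'' hn'' => h n'' ?_
          rw [hn'', h3]
          simp
        · obtain rfl := Option.some.inj hℓ
          simp [Label.word, wordAct_append, wordAct_popWord] at hz
        · omega
    | succ a iha =>
      refine LosesAt.exist hΓ rfl fun q' ℓ z' hℓ hz => ?_
      obtain ⟨K', n'⟩ := z'
      rcases q' with _ | s | ⟨t', j'⟩ | t' | ⟨p', t', c', j'⟩ | _ <;>
        simp only [lab, reduceCtorEq] at hℓ
      · split_ifs at hℓ; omega
      · simp only [List.replicate_succ, List.cons_append, pushStacks_cons] at hz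
        split_ifs at hℓ with h1 h2 h3 h3 h3
        · obtain rfl := Option.some.inj hℓ
          simp [Label.word, wordAct_append, wordAct_popWord] at hz
        · obtain rfl := Option.some.inj hℓ
          obtain ⟨rfl, rfl⟩ := h1
          obtain ⟨rfl, hj'⟩ := h3
          subst h2
          obtain ⟨rfl, hn⟩ := eq_of_wordAct_word (by rw [wordAct_popWord, if_pos rfl]) hz
          refine iha n' fun n'' hn'' => h n'' ?_
          rw [hn'', ← hn]
          push_cast
          ring
        · omega

/-- The universal player can push any values of the counters. -/
theorem losesFrom_push {t : M.Trans} {y : ℕ → ℕ} {K : ℤ × List ℤ} {n : ℕ}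
    (h : LosesFrom Γ e x₀ (choice t) (pushStacks (block y 0 M.numRegs) K) n)
    (j : ℕ) (hj : j < M.numRegs + 1) (m : ℕ) (hm : j + m = M.numRegs) :
    LosesFrom Γ e x₀ (push t ⟨j, hj⟩) (pushStacks (block y j m) K) n := by
  induction j generalizing m with
  | zero =>
    refine LosesFrom.univ (q' := choice t) (n' := n) (v := []) (z := 0) rfl (by simp [lab]) rfl
      (by simp) ?_
    rwa [show m = M.numRegs by omega]
  | succ j ih =>
    have hstep : ∀ d ≤ y j, LosesFrom Γ e x₀ (push t ⟨j, by omega⟩)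
        (pushStacks (List.replicate (y j - d) false ++ true :: block y (j + 1) m) K) n := by
      intro d
      induction d with
      | zero => exact fun _ => ih (by omega) (m + 1) (by omega)
      | succ d ihd =>
        intro hd
        refine LosesFrom.univ (q' := push t ⟨j, by omega⟩) (n' := n) (v := pushWord false)
          (z := 0) rfl (by simp [lab]; omega) (wordAct_pushWord _ _ _) (by simp) ?_
        have := ihd (by omega)
        rwa [show y j - d = y j - (d + 1) + 1 by omega, List.replicate_succ, List.cons_append,
          pushStacks_cons] at this
    refine LosesFrom.univ (q' := push t ⟨j, by omega⟩) (n' := n) (v := pushWord true)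
      (z := 0) rfl (by simp [lab]) (wordAct_pushWord _ _ _) (by simp) ?_
    simpa [pushStacks_cons] using hstep (y j) le_rfl

/-- A complaint about correct values costs the existential player some of the surplus `B` of the
value of `b` over the sum of the old counters. -/
theorem losesFrom_complaint (hΓ : Γ ⊆ graphIV) {t : M.Trans} {x y : ℕ → ℕ} {K : ℤ × List ℤ}
    {n B : ℕ} (hs : (M.kind t).Step (M.reg t) x y)
    (hB : weightedSum 1 x 0 M.numRegs + B = n)
    (hstart : ∀ B' < B, ∀ K, LosesFrom Γ e x₀ start K B') (c : Fin M.numRegs × Bool) :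
    LosesFrom Γ e x₀ (pop false t c 0)
      (pushStacks (block y 0 M.numRegs) (pushStacks (block x 0 M.numRegs) K)) n := by
  refine losesFrom_pop hΓ M.numRegs 0 n (by simp) fun n₁ hn₁ => ?_
  refine LosesAt.exist hΓ rfl fun q' ℓ z' hℓ hz => ?_
  obtain ⟨K', n'⟩ := z'
  rcases q' with _ | s | ⟨t', j'⟩ | t' | ⟨p', t', c', j'⟩ | _ <;>
    simp only [lab, reduceCtorEq, Bool.false_eq_true, false_and, if_false] at hℓ
  have hlast : ((Fin.last M.numRegs : Fin (M.numRegs + 1)) : ℕ) = M.numRegs := rfl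
  split_ifs at hℓ with h1 h2 h3 h3 h3
  · have := j'.2; omega
  · omega
  · obtain rfl := Option.some.inj hℓ
    obtain ⟨rfl, rfl⟩ := h1
    obtain rfl : p' = true := by cases p' <;> simp_all
    obtain rfl : j' = 0 := Fin.ext h3.2.2
    obtain ⟨rfl, hn'⟩ := eq_of_wordAct_word rfl hz
    obtain rfl : n₁ = n' := by omega
    refine losesFrom_pop hΓ M.numRegs 0 _ (by simp) fun n₂ hn₂ => ?_
    refine LosesAt.exist hΓ rfl fun q' ℓ z' hℓ hz => ?_
    obtain ⟨K', n'⟩ := z'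
    rcases q' with _ | s | ⟨t', j'⟩ | t' | ⟨p', t', c', j'⟩ | _ <;>
      simp only [lab, reduceCtorEq, Bool.true_eq_false, false_and, if_false] at hℓ
    · rw [if_pos ⟨trivial, hlast⟩] at hℓ
      obtain rfl := Option.some.inj hℓ
      obtain ⟨rfl, hn'⟩ := eq_of_wordAct_word rfl hz
      refine hstart n' ?_ _
      obtain ⟨i, d⟩ := c
      have htot := complaint_total t i d x y
      have hyi : (y i : ℤ) = x i + M.delta t i := hs.1 i
      simp only [Fin.val_zero] at hn₁ hn₂
      cases d
      · simp only [Bool.false_eq_true, if_false] at htot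
        omega
      · simp only [if_true] at htot
        split_ifs at htot with hz
        · have := hs.2 hz.1
          rw [hz.2] at this
          omega
        · omega
    · split_ifs at hℓ with h1 h2 h3 h3
      · have := j'.2; omega
      · omega

theorem losesFrom_main (hΓ : Γ ⊆ graphIV) {B : ℕ}
    (hstart : ∀ B' < B, ∀ K, LosesFrom Γ e x₀ start K B') {y : ℕ → ℕ}
    {c : M.State × (ℕ → ℕ)} (h : Relation.ReflTransGen M.Step c (M.final, y)) :
    ∀ (K : ℤ × List ℤ) (n : ℕ), weightedSum 1 c.2 0 M.numRegs + B = n →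
      LosesFrom Γ e x₀ (main c.1) (pushStacks (block c.2 0 M.numRegs) K) n := by
  induction h using Relation.ReflTransGen.head_induction_on with
  | refl =>
    intro K n _
    exact LosesFrom.univ (q' := halt) (n' := n) (v := []) (z := 0) rfl (by simp [lab]) rfl
      (by simp) (losesFrom_halt hΓ _ _)
  | @head c d hs _ ih =>
    intro K n hn
    obtain ⟨t, ht, ht', hs⟩ := hs
    refine LosesFrom.univ (q' := push t (Fin.last _)) (n' := n) (v := []) (z := 0) rfl
      (by simp [lab, ht]) rfl (by simp) ?_
    refine losesFrom_push (y := d.2) (K := pushStacks (block c.2 0 M.numRegs) K) ?_ M.numRegs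
      (by omega) 0 (by omega)
    refine LosesAt.exist hΓ rfl fun q' ℓ z' hℓ hz => ?_
    obtain ⟨K', n'⟩ := z'
    rcases q' with _ | s | ⟨t', j'⟩ | t' | ⟨p', t', c', j'⟩ | _ <;>
      simp only [lab, reduceCtorEq] at hℓ
    · split_ifs at hℓ with h1
      obtain rfl := Option.some.inj hℓ
      obtain ⟨rfl, hn'⟩ := eq_of_wordAct_word rfl hz
      rw [h1, ht']
      refine ih _ n' ?_
      rw [weightedSum_one_of_step hs]
      omega
    · split_ifs at hℓ with h1
      obtain rfl := Option.some.inj hℓ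
      obtain ⟨rfl, rfl, h3⟩ := h1
      obtain rfl : j' = 0 := Fin.ext h3
      obtain ⟨rfl, hn'⟩ := eq_of_wordAct_word rfl hz
      exact losesFrom_complaint hΓ hs (by omega) hstart c'

/-- From the start, the universal player wins for every surplus `B`, by induction on `B`. -/
theorem losesFrom_start (hΓ : Γ ⊆ graphIV) (h : M.Halts x₀) (B : ℕ) (K : ℤ × List ℤ) :
    LosesFrom Γ e x₀ start K B := by
  induction B using Nat.strong_induction_on generalizing K with
  | _ B ih =>
    obtain ⟨y, hy⟩ := h
    have h0 := weightedSum_one_nonneg x₀ 0 M.numRegs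
    exact LosesFrom.univ (q' := main M.start) (n' := (B + weightedSum 1 x₀ 0 M.numRegs).toNat)
      (v := stackWord (block x₀ 0 M.numRegs)) (z := weightedSum 1 x₀ 0 M.numRegs) rfl
      (by simp [lab]) (wordAct_stackWord _ _ _) (by omega)
      (losesFrom_main hΓ (fun B' hB' K => ih B' hB' K) hy K _ (by dsimp only; omega))

end Lose

end GameState

/-! ### Counter programs -/

/-- Nondeterministic programs for counters numbered by natural numbers. -/
inductive Prog
  | atom (κ : OpKind) (i : ℕ)
  | seq (p q : Prog)
  | star (p : Prog)

namespace Prog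

/-- The program `p` can turn the counter values `x` into `y`. -/
def Sem : Prog → (ℕ → ℕ) → (ℕ → ℕ) → Prop
  | atom κ i, x, y => κ.Step i x y
  | seq p q, x, y => ∃ z, p.Sem x z ∧ q.Sem z y
  | star p, x, y => Relation.ReflTransGen p.Sem x y

/-- All counters of a program are below `k`. -/
def Below (k : ℕ) : Prog → Prop
  | atom _ i => i < k
  | seq p q => p.Below k ∧ q.Below k
  | star p => p.Below k

theorem Below.mono {k k' : ℕ} (h : k ≤ k') {p : Prog} (hp : p.Below k) : p.Below k' := by
  induction p with
  | atom κ i => exact lt_of_lt_of_le hp h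
  | seq p q ihp ihq => exact ⟨ihp hp.1, ihq hp.2⟩
  | star p ih => exact ih hp

/-- Small steps: the state is the list of the programs that are still to be executed. -/
inductive Small : List Prog → OpKind → ℕ → List Prog → Prop
  | atom (κ i K) : Small (atom κ i :: K) κ i K
  | seq (p q K) : Small (seq p q :: K) .nop 0 (p :: q :: K)
  | exit (p K) : Small (star p :: K) .nop 0 K
  | loop (p K) : Small (star p :: K) .nop 0 (p :: star p :: K)

/-- The states that occur while `p` is executed in front of `K`, without `K` itself. -/
def states : Prog → List Prog → Set (List Prog)
  | atom κ i, K => {atom κ i :: K}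
  | seq p q, K => {seq p q :: K} ∪ (p.states (q :: K) ∪ q.states K)
  | star p, K => {star p :: K} ∪ p.states (star p :: K)

theorem finite_states (p : Prog) (K : List Prog) : (p.states K).Finite := by
  induction p generalizing K with
  | atom κ i => exact Set.finite_singleton _
  | seq p q ihp ihq => exact (Set.finite_singleton _).union ((ihp _).union (ihq _))
  | star p ih => exact (Set.finite_singleton _).union (ih _)

theorem cons_mem_states (p : Prog) (K : List Prog) : p :: K ∈ p.states K := by
  cases p <;> simp [states]

theorem states_closed {p : Prog} {K L L' : List Prog} {κ : OpKind} {i : ℕ}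
    (hL : L ∈ p.states K) (h : Small L κ i L') : L' = K ∨ L' ∈ p.states K := by
  induction p generalizing K with
  | atom κ i =>
    obtain rfl := hL
    cases h
    exact .inl rfl
  | seq p q ihp ihq =>
    rcases hL with rfl | hL | hL
    · cases h
      exact .inr (.inr (.inl (cons_mem_states p _)))
    · rcases ihp hL with rfl | h'
      · exact .inr (.inr (.inr (cons_mem_states q _)))
      · exact .inr (.inr (.inl h'))
    · exact (ihq hL).imp_right fun h' => .inr (.inr h')
  | star p ih =>
    rcases hL with rfl | hL
    · cases h
      · exact .inl rfl
      · exact .inr (.inr (cons_mem_states p _))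
    · rcases ih hL with rfl | h'
      · exact .inr (.inl rfl)
      · exact .inr (.inr h')

theorem small_lt {p : Prog} {k : ℕ} (hk : 0 < k) (hp : p.Below k) {K L L' : List Prog} {κ : OpKind}
    {i : ℕ} (hL : L ∈ p.states K) (h : Small L κ i L') : i < k := by
  induction p generalizing K with
  | atom κ i =>
    obtain rfl := hL
    cases h
    exact hp
  | seq p q ihp ihq =>
    rcases hL with rfl | hL | hL
    · cases h
      exact hk
    · exact ihp hp.1 hL
    · exact ihq hp.2 hL
  | star p ih =>
    rcases hL with rfl | hL
    · cases h <;> exact hk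
    · exact ih hp hL

theorem finite_small (L : List Prog) :
    {t : OpKind × ℕ × List Prog | Small L t.1 t.2.1 t.2.2}.Finite := by
  rcases L with _ | ⟨_ | _ | _, K⟩
  · exact Set.finite_empty.subset fun t ht => by cases ht
  · rename_i κ i
    refine (Set.finite_singleton (κ, i, K)).subset ?_
    rintro ⟨κ', i', L'⟩ ht
    cases ht
    rfl
  · rename_i p q
    refine (Set.finite_singleton (OpKind.nop, 0, p :: q :: K)).subset ?_
    rintro ⟨κ', i', L'⟩ ht
    cases ht
    rfl
  · rename_i p
    refine (Set.toFinite {(OpKind.nop, 0, K), (OpKind.nop, 0, p :: star p :: K)}).subset ?_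
    rintro ⟨κ', i', L'⟩ ht
    cases ht
    · exact .inl rfl
    · exact .inr rfl

/-- Big-step semantics of a list of programs. -/
def SemList : List Prog → (ℕ → ℕ) → (ℕ → ℕ) → Prop
  | [], x, y => x = y
  | p :: K, x, y => ∃ z, p.Sem x z ∧ SemList K z y

theorem step_nop {x : ℕ → ℕ} {i : ℕ} : OpKind.nop.Step i x x := by
  simp [OpKind.Step, OpKind.sign]

theorem eq_of_step_nop {x y : ℕ → ℕ} {i : ℕ} (h : OpKind.nop.Step i x y) : x = y := by
  funext j
  have := h.1 j
  simp [OpKind.sign] at this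
  exact this.symm

theorem SemList.of_small {L L' : List Prog} {κ : OpKind} {i : ℕ} {x y z : ℕ → ℕ}
    (h : Small L κ i L') (hs : κ.Step i x y) (hL : SemList L' y z) : SemList L x z := by
  cases h with
  | atom => exact ⟨y, hs, hL⟩
  | seq p q K =>
    obtain rfl := eq_of_step_nop hs
    obtain ⟨u, hu, v, hv, hK⟩ := hL
    exact ⟨v, ⟨u, hu, hv⟩, hK⟩
  | exit p K =>
    obtain rfl := eq_of_step_nop hs
    exact ⟨x, .refl, hL⟩
  | loop p K =>
    obtain rfl := eq_of_step_nop hs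
    obtain ⟨u, hu, v, hv, hK⟩ := hL
    exact ⟨v, .head hu hv, hK⟩

/-- One small step together with its effect on the counters. -/
def SmallStep (c d : List Prog × (ℕ → ℕ)) : Prop :=
  ∃ κ i, Small c.1 κ i d.1 ∧ κ.Step i c.2 d.2

theorem SmallStep.nop {L L' : List Prog} {i : ℕ} (h : Small L .nop i L') (x : ℕ → ℕ) :
    SmallStep (L, x) (L', x) :=
  ⟨_, _, h, step_nop⟩

theorem SemList.of_run {c : List Prog × (ℕ → ℕ)} {y : ℕ → ℕ}
    (h : Relation.ReflTransGen SmallStep c ([], y)) : SemList c.1 c.2 y := by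
  induction h using Relation.ReflTransGen.head_induction_on with
  | refl => rfl
  | head hs _ ih =>
    obtain ⟨κ, i, h1, h2⟩ := hs
    exact ih.of_small h1 h2

theorem Sem.run {p : Prog} {x y : ℕ → ℕ} (h : p.Sem x y) (K : List Prog) :
    Relation.ReflTransGen SmallStep (p :: K, x) (K, y) := by
  induction p generalizing x y K with
  | atom κ i => exact .single ⟨κ, i, .atom _ _ _, h⟩
  | seq p q ihp ihq =>
    obtain ⟨z, hp, hq⟩ := h
    exact (Relation.ReflTransGen.single (.nop (.seq p q K) x)).trans ((ihp hp _).trans (ihq hq _))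
  | star p ih =>
    induction h using Relation.ReflTransGen.head_induction_on with
    | refl => exact .single (.nop (.exit _ _) _)
    | head hs _ ih' => exact .trans (.single (.nop (.loop p K) _)) ((ih hs _).trans ih')

/-- Every program is executed by a counter machine, whose states are the lists of programs that
occur as continuations. -/
theorem exists_machine (p : Prog) : ∃ M : CounterMachine, ∀ x, M.Halts x ↔ ∃ y, p.Sem x y := by
  obtain ⟨k, hk, hp⟩ : ∃ k, 0 < k ∧ p.Below k := by
    induction p with
    | atom κ i => exact ⟨i + 1, by omega, Nat.lt_succ_self i⟩
    | seq p q ihp ihq =>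
      obtain ⟨k, hk, h⟩ := ihp
      obtain ⟨k', hk', h'⟩ := ihq
      exact ⟨max k k', by omega, h.mono (le_max_left _ _), h'.mono (le_max_right _ _)⟩
    | star p ih => exact ih
  let S : Set (List Prog) := insert [] (p.states [])
  have hS : S.Finite := (p.finite_states []).insert _
  let T : Set (List Prog × OpKind × ℕ × List Prog) :=
    ⋃ L ∈ p.states [], (fun t => (L, t)) '' {t : OpKind × ℕ × List Prog | Small L t.1 t.2.1 t.2.2}
  have hT : T.Finite := (p.finite_states []).biUnion fun L _ => (finite_small L).image _
  have hmem : ∀ t : List Prog × OpKind × ℕ × List Prog,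
      t ∈ T ↔ t.1 ∈ p.states [] ∧ Small t.1 t.2.1 t.2.2.1 t.2.2.2 := by
    rintro ⟨L, κ, i, L'⟩
    simp [T, and_comm]
  have := hS.fintype
  have := hT.fintype
  let M : CounterMachine :=
    { State := S
      Trans := T
      start := ⟨[p], .inr (cons_mem_states p [])⟩
      final := ⟨[], .inl rfl⟩
      src := fun t => ⟨t.1.1, .inr ((hmem _).1 t.2).1⟩
      tgt := fun t => ⟨t.1.2.2.2, states_closed ((hmem _).1 t.2).1 ((hmem _).1 t.2).2⟩
      kind := fun t => t.1.2.1
      reg := fun t => t.1.2.2.1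
      numRegs := k
      numRegs_pos := hk
      reg_lt := fun t => small_lt hk hp ((hmem _).1 t.2).1 ((hmem _).1 t.2).2 }
  refine ⟨M, fun x => ⟨?_, ?_⟩⟩
  · rintro ⟨y, h⟩
    have hrun : Relation.ReflTransGen SmallStep ([p], x) ([], y) := by
      have hf : ∀ c d : M.State × (ℕ → ℕ), M.Step c d → SmallStep (c.1.1, c.2) (d.1.1, d.2) := by
        rintro ⟨L, x⟩ ⟨L', y⟩ ⟨t, rfl, rfl, hs⟩
        exact ⟨_, _, ((hmem _).1 t.2).2, hs⟩
      exact Relation.ReflTransGen.lift (fun c : M.State × (ℕ → ℕ) => (c.1.1, c.2)) hf _ _ h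
    obtain ⟨z, hz, -⟩ := SemList.of_run hrun
    exact ⟨z, hz⟩
  · rintro ⟨y, h⟩
    have hlift : ∀ c d : List Prog × (ℕ → ℕ), Relation.ReflTransGen SmallStep c d →
        ∀ hc : c.1 ∈ S, ∃ hd : d.1 ∈ S,
          Relation.ReflTransGen M.Step ((⟨c.1, hc⟩ : S), c.2) ((⟨d.1, hd⟩ : S), d.2) := by
      intro c d h hc
      induction h with
      | refl => exact ⟨hc, .refl⟩
      | tail _ hs ih =>
        obtain ⟨hd, hr⟩ := ih
        obtain ⟨κ, i, h1, h2⟩ := hs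
        rcases hd with hd | hd
        · rw [hd] at h1
          cases h1
        · exact ⟨states_closed hd h1, hr.tail ⟨⟨(_, κ, i, _), (hmem _).2 ⟨hd, h1⟩⟩, rfl, rfl, h2⟩⟩
    obtain ⟨hd, hr⟩ := hlift _ _ (h.run []) (.inr (cons_mem_states p []))
    exact ⟨y, hr⟩

/-! ### Primitive recursive functions by counter programs -/

/-- Started from `x`, the program `p` has the result `y` and no other. -/
def Does (p : Prog) (x y : ℕ → ℕ) : Prop := ∀ z, p.Sem x z ↔ z = y

theorem Does.seq {p q : Prog} {x y z : ℕ → ℕ} (hp : p.Does x y) (hq : q.Does y z) :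
    (seq p q).Does x z := by
  intro w
  simp only [Sem, hp _, exists_eq_left, hq w]

theorem Does.congr {p : Prog} {x y z : ℕ → ℕ} (hp : p.Does x y) (h : y = z) : p.Does x z := h ▸ hp

theorem does_nop (i : ℕ) (x : ℕ → ℕ) : (atom .nop i).Does x x :=
  fun _ => ⟨fun h => (eq_of_step_nop h).symm, fun h => h ▸ step_nop⟩

theorem does_inc (i : ℕ) (x : ℕ → ℕ) : (atom .inc i).Does x (Function.update x i (x i + 1)) := by
  intro z
  simp only [Sem, OpKind.Step, OpKind.sign, reduceCtorEq, false_imp_iff, and_true, funext_iff]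
  refine forall_congr' fun j => ?_
  by_cases hj : j = i
  · subst hj
    simp only [if_true, Function.update_self]
    omega
  · simp [hj]

theorem sem_dec_iff {i : ℕ} {x y : ℕ → ℕ} :
    (atom .dec i).Sem x y ↔ 0 < x i ∧ y = Function.update x i (x i - 1) := by
  simp only [Sem, OpKind.Step, OpKind.sign, reduceCtorEq, false_imp_iff, and_true]
  constructor
  · intro h
    have hi := h i
    rw [if_pos rfl] at hi
    refine ⟨by omega, funext fun j => ?_⟩
    have := h j
    by_cases hj : j = i
    · subst hj
      rw [Function.update_self]
      omega
    · simp only [hj, if_false] at this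
      rw [Function.update_of_ne hj]
      omega
  · rintro ⟨hi, rfl⟩ j
    by_cases hj : j = i
    · subst hj
      simp only [Function.update_self, if_true]
      omega
    · simp [hj]

theorem sem_zero_iff {i : ℕ} {x y : ℕ → ℕ} : (atom .zero i).Sem x y ↔ x i = 0 ∧ y = x := by
  simp only [Sem, OpKind.Step, OpKind.sign, ite_self, add_zero, Nat.cast_inj, forall_const]
  rw [and_comm, funext_iff]

/-- While counter `i` is positive, decrement it and execute `p`. -/
def loop (i : ℕ) (p : Prog) : Prog := seq (star (seq (atom .dec i) p)) (atom .zero i)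

/-- The result of a loop of `a` rounds, where `s d` are the counter values after `d` rounds. -/
theorem does_loop {i a : ℕ} {p : Prog} {s : ℕ → ℕ → ℕ} (hs : ∀ d ≤ a, s d i = a - d)
    (hp : ∀ d < a, p.Does (Function.update (s d) i (a - (d + 1))) (s (d + 1))) :
    (loop i p).Does (s 0) (s a) := by
  induction a generalizing s with
  | zero =>
    intro z
    have h0 : s 0 i = 0 := hs 0 le_rfl
    simp only [loop, Sem]
    constructor
    · rintro ⟨w, hw, hz⟩
      obtain ⟨-, rfl⟩ := sem_zero_iff.1 hz
      rcases hw.cases_head with rfl | ⟨u, ⟨v, hv, -⟩, -⟩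
      · rfl
      · exact absurd (sem_dec_iff.1 hv).1 (by omega)
    · rintro rfl
      exact ⟨_, .refl, sem_zero_iff.2 ⟨h0, rfl⟩⟩
  | succ a ih =>
    have h0 : s 0 i = a + 1 := hs 0 (by omega)
    have hbody : ∀ u, (seq (atom .dec i) p).Sem (s 0) u ↔ u = s 1 := by
      intro u
      simp only [Sem]
      constructor
      · rintro ⟨v, hv, hu⟩
        obtain ⟨-, rfl⟩ := sem_dec_iff.1 hv
        rw [h0] at hu
        exact (hp 0 (by omega) u).1 hu
      · rintro rfl
        exact ⟨_, sem_dec_iff.2 ⟨by omega, rfl⟩, by rw [h0]; exact (hp 0 (by omega) _).2 rfl⟩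
    have ih' := ih (s := fun d => s (d + 1)) (fun d hd => by rw [hs _ (by omega)]; omega)
      (fun d hd => by
        have := hp (d + 1) (by omega)
        rwa [show a + 1 - (d + 1 + 1) = a - (d + 1) by omega] at this)
    intro z
    rw [← ih' z]
    simp only [loop, Sem]
    constructor
    · rintro ⟨w, hw, hz⟩
      rcases hw.cases_head with rfl | ⟨u, hu, hw⟩
      · exact absurd (sem_zero_iff.1 hz).1 (by omega)
      · obtain rfl := (hbody u).1 hu
        exact ⟨w, hw, hz⟩
    · rintro ⟨w, hw, hz⟩
      exact ⟨w, .head ((hbody _).2 rfl) hw, hz⟩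

/-- Set counter `i` to zero. -/
def clear (i : ℕ) : Prog := loop i (atom .nop i)

theorem does_clear (i : ℕ) (x : ℕ → ℕ) : (clear i).Does x (Function.update x i 0) := by
  have := does_loop (i := i) (a := x i) (p := atom .nop i)
    (s := fun d => Function.update x i (x i - d)) (by simp)
    fun d hd => (does_nop i _).congr (by simp)
  simpa [clear] using this

/-- Empty counter `i` while adding its value to counter `j`. -/
def move (i j : ℕ) : Prog := loop i (atom .inc j)

theorem does_move {i j : ℕ} (hij : i ≠ j) (x : ℕ → ℕ) :
    (move i j).Does x (Function.update (Function.update x i 0) j (x j + x i)) := by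
  have := does_loop (i := i) (a := x i) (p := atom .inc j)
    (s := fun d => Function.update (Function.update x i (x i - d)) j (x j + d))
    (fun d _ => by simp [hij]) fun d hd => (does_inc j _).congr (by
      funext l
      simp only [Function.update_apply]
      split_ifs <;> omega)
  simpa [move] using this

/-- Add counter `i` to counter `j`, with the help of the empty counter `k`. -/
def copyAdd (i j k : ℕ) : Prog := seq (loop i (seq (atom .inc j) (atom .inc k))) (move k i)

theorem does_copyAdd {i j k : ℕ} (hij : i ≠ j) (hik : i ≠ k) (hjk : j ≠ k) {x : ℕ → ℕ}
    (hk : x k = 0) : (copyAdd i j k).Does x (Function.update x j (x j + x i)) := by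
  have := does_loop (i := i) (a := x i) (p := seq (atom .inc j) (atom .inc k))
    (s := fun d => Function.update (Function.update (Function.update x i (x i - d)) j (x j + d)) k d)
    (fun d _ => by simp [hij, hik]) fun d hd => ((does_inc j _).seq (does_inc k _)).congr (by
      funext l
      simp only [Function.update_apply]
      split_ifs <;> omega)
  have hloop : (loop i (seq (atom .inc j) (atom .inc k))).Does x
      (Function.update (Function.update (Function.update x i 0) j (x j + x i)) k (x i)) := by
    convert this using 1
    · funext l
      simp only [Function.update_apply]
      split_ifs <;> first | omega | (subst_vars; omega)
    · simp
  refine (hloop.seq (does_move hik.symm _)).congr ?_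
  funext l
  simp only [Function.update_apply]
  split_ifs <;> first | omega | (subst_vars; omega)

/-- Clear the counters `N, …, N + l - 1`. -/
theorem exists_does_clear (N l : ℕ) : ∃ p : Prog, ∀ x,
    p.Does x (fun j => if N ≤ j ∧ j < N + l then 0 else x j) := by
  induction l with
  | zero => exact ⟨atom .nop 0, fun x => (does_nop 0 x).congr (by funext j; grind)⟩
  | succ l ih =>
    obtain ⟨p, hp⟩ := ih
    refine ⟨seq p (clear (N + l)), fun x => ((hp x).seq (does_clear _ _)).congr ?_⟩
    funext j
    simp only [Function.update_apply]
    grind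

/-- Every primitive recursive function `f` is computed by a counter program: it adds the value of
`f` at the counters `r i` to the counter `o`, using as scratch space the counters from `N` on, which
are empty before and after. -/
theorem exists_does_of_primrec {n : ℕ} {f : List.Vector ℕ n → ℕ} (hf : Nat.Primrec' f) :
    ∀ (r : Fin n → ℕ) (o N : ℕ), (∀ i, r i < N) → o < N → (∀ i, r i ≠ o) →
      ∃ p : Prog, ∀ x : ℕ → ℕ, (∀ j, N ≤ j → x j = 0) →
        p.Does x (Function.update x o (x o + f (List.Vector.ofFn fun i => x (r i)))) := by
  induction hf with
  | zero =>
    exact fun r o N _ _ _ => ⟨atom .nop 0, fun x _ => (does_nop 0 x).congr (by simp)⟩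
  | succ =>
    intro r o N hr ho hro
    refine ⟨seq (atom .inc o) (copyAdd (r 0) o N), fun x hx => ?_⟩
    have hN : x N = 0 := hx N le_rfl
    have h0 := hr 0
    refine ((does_inc o x).seq (does_copyAdd (hro 0) (by omega) (by omega) ?_)).congr ?_
    · rwa [Function.update_of_ne (by omega)]
    · have := hro 0
      funext j
      simp only [Function.update_apply, List.Vector.ofFn, List.Vector.head_cons]
      split_ifs <;> omega
  | get i =>
    intro r o N hr ho hro
    refine ⟨copyAdd (r i) o N, fun x hx => ?_⟩
    have := hr i
    simpa using does_copyAdd (hro i) (by omega) (by omega) (hx N le_rfl)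
  | @comp m n f g _ _ ihf ihg =>
    intro r o N hr ho hro
    -- The values of the functions `g i` are stored in the counters `N + i`.
    have hargs : ∀ l ≤ n, ∃ p : Prog, ∀ x : ℕ → ℕ, (∀ j, N ≤ j → x j = 0) →
        p.Does x (fun j => if h : N ≤ j ∧ j - N < n ∧ j < N + l then
          g ⟨j - N, h.2.1⟩ (List.Vector.ofFn fun i => x (r i)) else x j) := by
      intro l
      induction l with
      | zero => exact fun _ => ⟨atom .nop 0, fun x _ => (does_nop 0 x).congr (by funext j; grind)⟩
      | succ l ih =>
        intro hl
        obtain ⟨p, hp⟩ := ih (by omega)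
        obtain ⟨q, hq⟩ := ihg ⟨l, hl⟩ r (N + l) (N + n) (fun i => by have := hr i; omega) (by omega)
          (fun i => by have := hr i; omega)
        refine ⟨seq p q, fun x hx => ((hp x hx).seq (hq _ fun j hj => ?_)).congr ?_⟩
        · rw [dif_neg (by omega), hx j (by omega)]
        · have hfun : (fun i => if h : N ≤ r i ∧ r i - N < n ∧ r i < N + l then
              g ⟨r i - N, h.2.1⟩ (List.Vector.ofFn fun i => x (r i)) else x (r i)) =
              fun i => x (r i) :=
            funext fun i => dif_neg (by have := hr i; omega)
          rw [hfun]
          funext j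
          simp only [Function.update_apply]
          by_cases hj : j = N + l
          · subst hj
            rw [if_pos rfl, dif_neg (by omega), dif_pos (by omega), hx _ (by omega), zero_add]
            simp
          · rw [if_neg hj]
            by_cases h : N ≤ j ∧ j - N < n ∧ j < N + l
            · rw [dif_pos h, dif_pos (by omega)]
            · rw [dif_neg h, dif_neg (by omega)]
    obtain ⟨p, hp⟩ := hargs n le_rfl
    obtain ⟨q, hq⟩ := ihf (fun i => N + i) o (N + n) (fun i => by simp) (by omega)
      (fun i => by omega)
    obtain ⟨u, hu⟩ := exists_does_clear N n
    refine ⟨seq p (seq q u), fun x hx => ((hp x hx).seq ((hq _ fun j hj => ?_).seq (hu _))).congr ?_⟩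
    · rw [dif_neg (by omega), hx j (by omega)]
    · have hfun : (fun i : Fin n => if h : N ≤ N + (i : ℕ) ∧ N + (i : ℕ) - N < n ∧
          N + (i : ℕ) < N + n then g ⟨N + (i : ℕ) - N, h.2.1⟩ (List.Vector.ofFn fun i => x (r i))
          else x (N + i)) = fun i => g i (List.Vector.ofFn fun i => x (r i)) := by
        funext i
        have := i.2
        rw [dif_pos (by omega)]
        simp
      rw [hfun]
      funext j
      simp only [Function.update_apply]
      by_cases hj : N ≤ j ∧ j < N + n
      · rw [if_pos hj, if_neg (by omega), hx j hj.1]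
      · rw [if_neg hj, dif_neg (by omega), dif_neg (by omega)]
  | @prec n f g _ _ ihf ihg =>
    intro r o N hr ho hro
    -- The counters `N`, …, `N + 3` hold the number of rounds left, the number of rounds done, the
    -- value computed so far, and the next value.
    obtain ⟨p, hp⟩ := ihf (fun i => r i.succ) (N + 2) (N + 4)
      (fun i => by have := hr i.succ; omega) (by omega) (fun i => by have := hr i.succ; omega)
    obtain ⟨q, hq⟩ := ihg (Fin.cons (N + 1) (Fin.cons (N + 2) fun i => r i.succ)) (N + 3) (N + 4)
      (fun i => by
        refine Fin.cases ?_ (fun i => Fin.cases ?_ (fun i => ?_) i) i <;> simp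
        have := hr i.succ
        omega)
      (by omega)
      (fun i => by
        refine Fin.cases ?_ (fun i => Fin.cases ?_ (fun i => ?_) i) i <;> simp
        have := hr i.succ
        omega)
    refine ⟨seq (copyAdd (r 0) N (N + 4)) (seq p (seq
      (loop N (seq q (seq (clear (N + 2)) (seq (move (N + 3) (N + 2)) (atom .inc (N + 1))))))
      (seq (clear (N + 1)) (move (N + 2) o)))), fun x hx => ?_⟩
    have h0 := hr 0
    have hr0 := hro 0
    have hx0 := hx N le_rfl
    have hx1 := hx (N + 1) (by omega)
    have hx2 := hx (N + 2) (by omega)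
    have hx3 := hx (N + 3) (by omega)
    set v : List.Vector ℕ n := List.Vector.ofFn fun i => x (r i.succ) with hv
    let val : ℕ → ℕ := fun d => d.rec (f v) fun y IH => g (y ::ᵥ IH ::ᵥ v)
    have hval0 : val 0 = f v := rfl
    have hval : ∀ d, val (d + 1) = g (d ::ᵥ val d ::ᵥ v) := fun d => rfl
    -- The counters after `d` rounds.
    let s : ℕ → ℕ → ℕ := fun d => Function.update
      (Function.update (Function.update x N (x (r 0) - d)) (N + 1) d) (N + 2) (val d)
    have hloop : (loop N (seq q (seq (clear (N + 2))
        (seq (move (N + 3) (N + 2)) (atom .inc (N + 1)))))).Does (s 0) (s (x (r 0))) := by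
      refine does_loop (fun d hd => by simp [s]) fun d hd => ?_
      refine ((hq _ fun j hj => ?_).seq ((does_clear _ _).seq
        ((does_move (by omega) _).seq (does_inc _ _)))).congr ?_
      · simp only [s, Function.update_apply]
        rw [if_neg (by omega), if_neg (by omega), if_neg (by omega), if_neg (by omega),
          hx j (by omega)]
      · have hfun : (List.Vector.ofFn fun i => (Function.update (s d) N (x (r 0) - (d + 1)))
            ((Fin.cons (N + 1) (Fin.cons (N + 2) fun i => r i.succ) : Fin (n + 2) → ℕ) i)) =
            d ::ᵥ val d ::ᵥ v := by
          have hrs : ∀ i : Fin n, Function.update (s d) N (x (r 0) - (d + 1)) (r i.succ) =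
              x (r i.succ) := by
            intro i
            have := hr i.succ
            simp only [s, Function.update_apply]
            rw [if_neg (by omega), if_neg (by omega), if_neg (by omega), if_neg (by omega)]
          simp only [List.Vector.ofFn, Fin.cons_zero, Fin.cons_succ, hrs, hv]
          simp [s]
        rw [hfun, ← hval]
        funext j
        simp only [s, Function.update_apply]
        split_ifs <;> first | omega | (subst_vars; omega)
    refine ((does_copyAdd (by omega) (by omega) (by omega) (hx _ (by omega))).seq
      ((hp _ fun j hj => ?_).seq (Does.seq (y := s (x (r 0))) ?_ ((does_clear _ _).seq
        (does_move (by omega) _))))).congr ?_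
    · rw [Function.update_of_ne (by omega), hx j (by omega)]
    · convert hloop using 1
      have hfun :
          (List.Vector.ofFn fun i => (Function.update x N (x N + x (r 0))) (r i.succ)) = v := by
        rw [hv]
        congr 1
        funext i
        have := hr i.succ
        rw [Function.update_of_ne (by omega)]
      rw [hfun]
      funext j
      simp only [s, hval0, Function.update_apply]
      split_ifs <;> first | omega | (subst_vars; omega)
    · change _ = Function.update x o (x o + val (x (r 0)))
      funext j
      simp only [s, Function.update_apply]
      split_ifs <;> first | omega | (subst_vars; omega)

end Prog

/-! ### An undecidable halting problem for counter machines -/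

/-- Counter `0` holds the input `n`, the other counters are empty. -/
def inputCounters (n : ℕ) : ℕ → ℕ := fun i => if i = 0 then n else 0

theorem exists_machine_of_primrec {g : ℕ → ℕ → ℕ} (hg : Primrec₂ g) :
    ∃ M : CounterMachine, ∀ n, M.Halts (inputCounters n) ↔ ∃ s, 0 < g n s := by
  obtain ⟨p, hp⟩ := Prog.exists_does_of_primrec (Nat.Primrec'.prim_iff₂.2 hg)
    (fun i => (i : ℕ)) 2 3 (fun i => by omega) (by omega) (fun i => by omega)
  -- The machine guesses `s` in counter `1`, computes `g n s` and subtracts one from it.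
  obtain ⟨M, hM⟩ := Prog.exists_machine
    (.seq (.star (.atom .inc 1)) (.seq p (.atom .dec 2)))
  refine ⟨M, fun n => (hM _).trans ?_⟩
  have hguess : ∀ y, (Prog.star (.atom .inc 1)).Sem (inputCounters n) y ↔
      ∃ s, y = Function.update (inputCounters n) 1 s := by
    intro y
    constructor
    · intro h
      induction h with
      | refl => exact ⟨0, by funext j; simp only [Function.update_apply, inputCounters]; grind⟩
      | tail _ h ih =>
        obtain ⟨s, rfl⟩ := ih
        exact ⟨s + 1, by rw [(Prog.does_inc 1 _ _).1 h]; simp⟩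
    · rintro ⟨s, rfl⟩
      induction s with
      | zero =>
        have h0 : Function.update (inputCounters n) 1 0 = inputCounters n :=
          Function.update_eq_self_iff.2 rfl
        rw [h0]
        exact .refl
      | succ s ih => exact ih.tail ((Prog.does_inc 1 _ _).2 (by simp))
  have hrun : ∀ s, p.Does (Function.update (inputCounters n) 1 s)
      (Function.update (Function.update (inputCounters n) 1 s) 2 (g n s)) := by
    intro s
    refine (hp _ fun j hj => ?_).congr ?_
    · rw [Function.update_of_ne (by omega), inputCounters, if_neg (by omega)]
    · simp [List.Vector.ofFn, inputCounters]
  constructor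
  · rintro ⟨y, z, hz, w, hw, hy⟩
    obtain ⟨s, rfl⟩ := (hguess z).1 hz
    obtain rfl := (hrun s w).1 hw
    exact ⟨s, by simpa using (Prog.sem_dec_iff.1 hy).1⟩
  · rintro ⟨s, hs⟩
    exact ⟨_, _, (hguess _).2 ⟨s, rfl⟩, _, (hrun s _).2 rfl,
      Prog.sem_dec_iff.2 ⟨by simpa using hs, rfl⟩⟩

theorem exists_undecidable_machine :
    ∃ M : CounterMachine, ¬ ComputablePred fun n => M.Halts (inputCounters n) := by
  have hg : Primrec₂ fun n s : ℕ =>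
      (Nat.Partrec.Code.evaln s (Denumerable.ofNat Nat.Partrec.Code n) 0).isSome.toNat :=
    (Primrec.dom_bool Bool.toNat).comp (Primrec.option_isSome.comp
      (Nat.Partrec.Code.primrec_evaln.comp
        ((Primrec.snd.pair ((Primrec.ofNat _).comp Primrec.fst)).pair (.const 0))))
  obtain ⟨M, hM⟩ := exists_machine_of_primrec hg
  refine ⟨M, fun hc => ComputablePred.halting_problem 0 ?_⟩
  obtain ⟨f, hf, hfM⟩ := ComputablePred.computable_iff.1 hc
  refine ComputablePred.computable_iff.2 ⟨fun c => f (Encodable.encode c),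
    hf.comp Computable.encode, funext fun c => propext ?_⟩
  have h := congrFun hfM (Encodable.encode c)
  rw [← h, hM]
  simp only [Denumerable.ofNat_encode, Part.dom_iff_mem, Nat.Partrec.Code.evaln_complete]
  constructor
  · rintro ⟨y, s, hs⟩
    exact ⟨s, by simp [Option.mem_def.1 hs]⟩
  · rintro ⟨s, hs⟩
    have : (Nat.Partrec.Code.evaln s c 0).isSome := by
      by_contra h
      rw [Bool.not_eq_true] at h
      rw [h] at hs
      exact absurd hs (by decide)
    obtain ⟨y, hy⟩ := Option.isSome_iff_exists.1 this
    exact ⟨y, s, hy⟩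

/-! ### Computing the arena from the input -/

theorem ArenaCode.Describes.unique {V : Type} {c : ArenaCode V} {n n' : ℕ}
    {A : GameArena V (Fin n)} {A' : GameArena V (Fin n')} (h : c.Describes A)
    (h' : c.Describes A') : ∃ hn : n = n', hn ▸ A = A' := by
  obtain ⟨h1, h2, h3, h4⟩ := h
  obtain ⟨h1', h2', h3', h4'⟩ := h'
  obtain rfl : n = n' := h1.symm.trans h1'
  refine ⟨rfl, ?_⟩
  have howner : A.owner = A'.owner := by
    funext p
    have h : A.owner p = .universal ↔ A'.owner p = .universal := by
      have := (h2 p).symm.trans (h2' p)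
      simpa [Fin.val_inj] using this
    cases hp : A.owner p <;> cases hp' : A'.owner p <;> simp_all
  have hδ : A.δ = A'.δ := by
    ext ⟨p, x, q⟩
    have := (h3 p x q).symm.trans (h3' p x q)
    simpa [Fin.val_inj] using this
  have hinit : A.init = A'.init := Fin.ext (h4.symm.trans h4')
  cases A
  cases A'
  simp_all

theorem primrec_replicate {α : Type} [Primcodable α] (x : α) :
    Primrec fun n : ℕ => List.replicate n x :=
  (Primrec.list_map Primrec.list_range (Primrec.const x).to₂).of_eq fun n => by simp

namespace GameState

variable {M : CounterMachine}

theorem stackWord_replicate_false (n : ℕ) :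
    stackWord (List.replicate n false) = List.replicate (n + n) (0, false) := by
  induction n with
  | zero => rfl
  | succ n ih =>
    change stackWord (List.replicate n false) ++ pushWord false = _
    rw [ih, show n + 1 + (n + 1) = (n + n) + 2 by omega, List.replicate_add (n + n) 2]
    rfl

/-- The label of the first transition is a computable function of the input. -/
theorem exists_input_word (M : CounterMachine) : ∃ u : List (Letter (Fin 3)), ∀ n,
    Label.word (stackWord (block (inputCounters n) 0 M.numRegs),
      weightedSum 1 (inputCounters n) 0 M.numRegs) =
    u ++ (List.replicate (n + n) (0, false) ++ List.replicate n (1, false)) := by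
  obtain ⟨k, hk⟩ : ∃ k, M.numRegs = k + 1 := ⟨M.numRegs - 1, by have := M.numRegs_pos; omega⟩
  refine ⟨stackWord (true :: block (inputCounters 0) 1 k), fun n => ?_⟩
  have hsum : weightedSum 1 (inputCounters n) 0 M.numRegs = n := by
    simp [weightedSum_eq_sum, inputCounters, M.numRegs_pos]
  have hblock : block (inputCounters n) 0 M.numRegs =
      List.replicate n false ++ true :: block (inputCounters 0) 1 k := by
    rw [hk, block, block_congr (x := inputCounters n) (y := inputCounters 0)]
    · rfl
    · intro i hi _
      rw [inputCounters, inputCounters, if_neg (by omega), if_neg (by omega)]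
  rw [hsum, hblock, Label.word, stackWord_append, stackWord_replicate_false, List.append_assoc]
  simp [counterWord]

theorem lab_of_ne_start {p : GameState M} (hp : p ≠ start) (x y : ℕ → ℕ) (q : GameState M) :
    lab x p q = lab y p q := by
  cases p
  · exact absurd rfl hp
  all_goals cases q <;> rfl

/-- The game arena for the machine `M` with input `n`. -/
noncomputable def arena {N : ℕ} (e : GameState M ≃ Fin N) (n : ℕ) : GameArena (Fin 3) (Fin N) :=
  labelledArena e owner (lab (inputCounters n)) (exists_lab _) start

/-- A description of the game arena is computable from the input, because the input affects a
single label. -/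
theorem exists_computable_code {N : ℕ} (e : GameState M ≃ Fin N) :
    ∃ code : ℕ → ArenaCode (Fin 3), Computable code ∧ ∀ n, (code n).Describes (arena e n) := by
  classical
  obtain ⟨u, hu⟩ := exists_input_word M
  let owned : List ℕ :=
    (Finset.univ.filter fun p : Fin N => owner (e.symm p) = .universal).toList.map Fin.val
  let fixed : List (ℕ × List (Letter (Fin 3)) × ℕ) :=
    ((labelledTransitions e (lab (inputCounters 0))).filter fun t => t.1 ≠ e start).toList.map
      fun t => ((t.1 : ℕ), t.2.1, (t.2.2 : ℕ))
  refine ⟨fun n => (N, owned, ((e start : ℕ), u ++ (List.replicate (n + n) (0, false) ++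
    List.replicate n (1, false)), (e (main M.start) : ℕ)) :: fixed, (e start : ℕ)), ?_, ?_⟩
  · refine Primrec.to_comp (.pair (.const _) (.pair (.const _) (.pair (Primrec.list_cons.comp
      (.pair (.const _) (.pair (Primrec.list_append.comp (.const _) (Primrec.list_append.comp
        ((primrec_replicate _).comp (Primrec.nat_add.comp .id .id)) (primrec_replicate _)))
        (.const _))) (.const _)) (.const _))))
  · refine fun n => ⟨rfl, fun p => ?_, fun p x q => ?_, rfl⟩
    · simp only [owned, List.mem_map, Finset.mem_toList, Finset.mem_filter, Finset.mem_univ,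
        true_and]
      exact exists_congr fun p' => and_comm
    · simp only [List.mem_cons, fixed, List.mem_map, Finset.mem_toList, Finset.mem_filter]
      constructor
      · rintro (h | ⟨⟨p', x', q'⟩, ⟨ht, hp'⟩, h⟩)
        · simp only [Prod.mk.injEq] at h
          obtain ⟨rfl, rfl, rfl⟩ := h
          exact ⟨e start, e (main M.start), rfl, rfl, mem_labelledArena.2
            ⟨_, by simp only [Equiv.symm_apply_apply, lab, if_true], hu n⟩⟩
        · simp only [Prod.mk.injEq] at h
          obtain ⟨rfl, rfl, rfl⟩ := h
          obtain ⟨ℓ, hℓ, hx⟩ := mem_labelledTransitions.1 ht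
          refine ⟨p', q', rfl, rfl, mem_labelledArena.2 ⟨ℓ, ?_, hx⟩⟩
          rwa [lab_of_ne_start (fun h => hp' ((Equiv.symm_apply_eq e).1 h)) _ (inputCounters 0)]
      · rintro ⟨p', q', rfl, rfl, h⟩
        obtain ⟨ℓ, hℓ, hx⟩ := mem_labelledArena.1 h
        by_cases hp' : p' = e start
        · left
          subst hp'
          rw [Equiv.symm_apply_apply] at hℓ
          generalize hq : e.symm q' = q at hℓ
          rcases q with _ | s | _ | _ | _ | _ <;> simp only [lab, reduceCtorEq] at hℓ
          split_ifs at hℓ with hs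
          obtain rfl := Option.some.inj hℓ
          obtain rfl := (Equiv.symm_apply_eq e).1 hq
          rw [← hx, hu n, hs]
        · right
          refine ⟨(p', x, q'), ⟨mem_labelledTransitions.2 ⟨ℓ, ?_, hx⟩, hp'⟩, rfl⟩
          rwa [lab_of_ne_start (fun h => hp' ((Equiv.symm_apply_eq e).1 h)) _ (inputCounters n)]

/-- The existential player wins without any initial credit if the machine does not halt. -/
theorem arena_wins {Γ : ValenceGraph (Fin 3)} (h₁ : s(0, 1) ∈ Γ) (h₂ : s(1, 2) ∈ Γ) {N : ℕ}
    (e : GameState M ≃ Fin N) {n : ℕ} (h : ¬ M.Halts (inputCounters n)) :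
    (arena e n).Wins (rightInvObjective Γ (Fin N)) .existential
      ((arena e n).init, wordClass Γ []) := by
  rw [wordClass_nil]
  exact labelledArena_wins (Inv M (inputCounters n)) (fun q L n hI ho => hI.existential h₁ h₂ ho)
    (fun q L n q' ℓ hI ho hℓ => hI.universal h₁ h₂ h ho hℓ) trivial

/-- No initial credit helps the existential player if the machine halts. -/
theorem arena_not_wins {Γ : ValenceGraph (Fin 3)} (hΓ : Γ ⊆ graphIV) {N : ℕ}
    (e : GameState M ≃ Fin N) {n : ℕ} (h : M.Halts (inputCounters n)) (w : List (Letter (Fin 3))) :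
    ¬ (arena e n).Wins (rightInvObjective Γ (Fin N)) .existential
      ((arena e n).init, wordClass Γ w) :=
  LosesAt.not_wins hΓ (fun z => losesFrom_start hΓ h z.2 z.1) w

end GameState

theorem not_isDecidable_of_reduction {α : Type} [Primcodable α] {P : DecisionProblem α}
    {p : ℕ → Prop} (hp : ¬ ComputablePred p) {g : ℕ → α} (hg : Computable g)
    (hi : ∀ n, g n ∈ P.instances) (hy : ∀ n, g n ∈ P.yes ↔ ¬ p n) : ¬ P.IsDecidable := by
  rintro ⟨f, hf, h⟩
  refine hp (ComputablePred.computable_iff.2 ⟨fun n => !f (g n),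
    (Primrec.not.to_comp).comp (hf.comp hg), funext fun n => propext ?_⟩)
  rw [Bool.not_eq_true', ← Bool.not_eq_true, h _ (hi n), hy, not_not]

theorem undecidable_of_path {Γ : ValenceGraph (Fin 3)} (h₁ : s(0, 1) ∈ Γ) (h₂ : s(1, 2) ∈ Γ)
    (hΓ : Γ ⊆ graphIV) : ¬ (FV Γ).IsDecidable ∧ ¬ (UV Γ).IsDecidable := by
  obtain ⟨M, hM⟩ := exists_undecidable_machine
  obtain ⟨N, ⟨e⟩⟩ := Finite.exists_equiv_fin (GameState M)
  obtain ⟨code, hcode, hdesc⟩ := GameState.exists_computable_code e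
  constructor
  · refine not_isDecidable_of_reduction hM (hcode.pair (.const [])) (fun n => ⟨N, _, hdesc n⟩)
      fun n => ⟨?_, fun h => ⟨N, _, hdesc n, GameState.arena_wins h₁ h₂ e h⟩⟩
    rintro ⟨N', A, hA, hw⟩ hH
    obtain ⟨rfl, rfl⟩ := (hdesc n).unique hA
    exact GameState.arena_not_wins hΓ e hH _ hw
  · refine not_isDecidable_of_reduction hM hcode (fun n => ⟨N, _, hdesc n⟩)
      fun n => ⟨?_, fun h => ⟨N, _, hdesc n, [], GameState.arena_wins h₁ h₂ e h⟩⟩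
    rintro ⟨N', A, hA, w, hw⟩ hH
    obtain ⟨rfl, rfl⟩ := (hdesc n).unique hA
    exact GameState.arena_not_wins hΓ e hH _ hw

theorem mainTheorem5 :
    (¬ (FV graphIII).IsDecidable ∧ ¬ (UV graphIII).IsDecidable) ∧
      (¬ (FV graphIV).IsDecidable ∧ ¬ (UV graphIV).IsDecidable) := by
  have hsub : graphIII ⊆ graphIV := by
    intro x hx
    simp only [graphIII, graphIV, Set.mem_insert_iff, Set.mem_singleton_iff] at hx ⊢
    tauto
  exact ⟨undecidable_of_path (by simp [graphIII]) (by simp [graphIII]) hsub,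
    undecidable_of_path (by simp [graphIV]) (by simp [graphIV]) subset_rfl⟩
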